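/- Let $\mathbb{K}$ be a field of characteristic zero, let $\mathbb{K}[\mathbb{G}_m]=\mathbb{K}[T^{\pm1}]$, and regard $\mathbb{K}[\mathbb{G}_m^{d}]=\mathbb{K}[T_1^{\pm1},\dots,T_d^{\pm1}]$ as a $\mathbb{K}[\mathbb{G}_m]$-algebra via $T\mapsto T_1\cdots T_d$. Let $\mathcal{A}$ be a (cohomologically unital) $\mathbb{Z}/2$-graded $A_\infty$-category over $\mathbb{K}$, on which $\mathbb{K}^*$ acts freely on objects and strictly on morphisms. A rational $\mathbb{G}_m$-action on $\mathcal{A}$ consists of such a strict action together with an $A_\infty$-category $\underline{\mathcal{A}}$ with the same objects, in which: (1) each $\hom_{\underline{\mathcal{A}}}(X_0,X_1)$ is a $\mathbb{Z}/2$-graded projective $\mathbb{K}[\mathbb{G}_m]$-module with fibre $\hom_{\mathcal{A}}(g(X_0),X_1)$ at every $g\in\mathbb{K}^*$; (2) the operations are $\mathbb{K}[\mathbb{G}_m^{d}]$-linear maps $\mu^d:\hom_{\underline{\mathcal{A}}}(X_{d-1},X_d)\otimes_{\mathbb{K}}\cdots\otimes_{\mathbb{K}}\hom_{\underline{\mathcal{A}}}(X_0,X_1)\to\mathbb{K}[\mathbb{G}_m^{d}]\otimes_{\mathbb{K}[\mathbb{G}_m]}\hom_{\underline{\mathcal{A}}}(X_0,X_d)[2-d]$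 which on fibres at $(g_d,\dots,g_1)$ are the operations of $\mathcal{A}$; (3) $\hom_{\underline{\mathcal{A}}}(g_0(X_0),g_1(X_1))$ is the pullback of $\hom_{\underline{\mathcal{A}}}(X_0,X_1)$ under multiplication by $g_1^{-1}g_0$, compatibly with the strict action and the $A_\infty$-operations. Assume such an action is given, and that $\underline{\mathcal{A}}$ is proper: every $H^i(\hom_{\underline{\mathcal{A}}}(X_0,X_1))$ is a finitely generated $\mathbb{K}[\mathbb{G}_m]$-module. Let $X$ be an object of $\mathcal{A}$ which is simple, $H^0(\hom_{\mathcal{A}}(X,X))=\mathbb{K}$, and infinitesimally equivariant, which means the following. Let $\mathcal{I}_e\subset\mathbb{K}[\mathbb{G}_m]$ be the maximal ideal of $e=1$ and $\mathfrak{g}^\vee=\mathcal{I}_e/\mathcal{I}_e^2$. Tensor $0\to\mathfrak{g}^\vee\to\mathbb{K}[\mathbb{G}_m]/\mathcal{I}_e^2\to\mathbb{K}\to0$ over $\mathbb{K}[\mathbb{G}_m]$ with $\hom_{\underline{\mathcal{A}}}(X,X)$; then the image $\mathrm{Def}^0_X\in\mathfrak{g}^\vee\otimes H^1(\hom_{\mathcal{A}}(X,X))$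 of the unit $[e_X]$ under the connecting morphism vanishes. Then $X$ admits a weakly $\mathbb{G}_m$-equivariant structure: there are $\rho^1\in\hom^0_{\underline{\mathcal{A}}}(X,X)$ and $\rho^2\in\mathbb{K}[\mathbb{G}_m^{2}]\otimes_{\mathbb{K}[\mathbb{G}_m]}\hom^{-1}_{\underline{\mathcal{A}}}(X,X)$ with $[\rho^1_e]=[e_X]\in H^0(\hom_{\mathcal{A}}(X,X))$ and, for all $g,g_1,g_2\in\mathbb{K}^*$, $$\mu^1_{\mathcal{A}}(\rho^1_g)=0,\qquad \mu^2_{\mathcal{A}}(\rho^1_{g_2},g_2\cdot\rho^1_{g_1})-\rho^1_{g_2g_1}+\mu^1_{\mathcal{A}}(\rho^2_{g_2,g_1})=0.$$ -/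

import Mathlib

open scoped TensorProduct LaurentPolynomial

noncomputable section

namespace AInfty

universe u v w u'

/-! ## Composable sequences -/

/-- `Chain H X Y d` is the type of composable sequences `(a_d, …, a_1)` of length `d`, with
`a_i ∈ H X_{i-1} X_i`, `X_0 = X` and `X_d = Y`; the entry added by `cons` is the last one, `a_d`. -/
inductive Chain {Ob : Type u} (H : Ob → Ob → Type v) : Ob → Ob → ℕ → Type (max u v)
  | nil (X : Ob) : Chain H X X 0
  | cons {X Y Z : Ob} {d : ℕ} (p : Chain H X Y d) (a : H Y Z) : Chain H X Z (d + 1)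

namespace Chain

variable {Ob : Type u} {H : Ob → Ob → Type v}

/-- Concatenation of composable sequences (first `p`, then `q`). -/
def comp {X Y Z : Ob} {d : ℕ} (p : Chain H X Y d) : {e : ℕ} → Chain H Y Z e → Chain H X Z (d + e)
  | _, nil _ => p
  | _, cons q a => cons (comp p q) a

/-- Apply a map to every entry of a composable sequence. -/
def map {Ob' : Type u'} {H' : Ob' → Ob' → Type w} (f : Ob → Ob')
    (φ : ∀ {X Y : Ob}, H X Y → H' (f X) (f Y)) :
    {X Y : Ob} → {d : ℕ} → Chain H X Y d → Chain H' (f X) (f Y) d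
  | X, _, _, nil _ => nil (f X)
  | _, _, _, cons p a => cons (map f φ p) (φ a)

/-- A way of cutting a composable sequence into two consecutive pieces. -/
structure Split (H : Ob → Ob → Type v) (X Z : Ob) where
  {mid : Ob}
  {m n : ℕ}
  fst : Chain H X mid m
  snd : Chain H mid Z n

/-- The list of all `d + 1` ways of cutting a composable sequence of length `d` in two pieces. -/
def splits : {X Z : Ob} → {d : ℕ} → Chain H X Z d → List (Split H X Z)
  | X, _, _, nil _ => [⟨nil X, nil X⟩]
  | _, _, _, cons p a => ⟨cons p a, nil _⟩ :: (splits p).map fun s => ⟨s.fst, cons s.snd a⟩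

end Chain

/-! ## `ℤ/2`-graded morphism modules -/

/-- Morphism modules over a commutative ring `S`, each with a `ℤ/2`-grading. -/
structure GradedQuiver (S : Type u) [CommRing S] (Ob : Type v) where
  Hom : Ob → Ob → Type w
  [addCommGroup : ∀ X Y, AddCommGroup (Hom X Y)]
  [module : ∀ X Y, Module S (Hom X Y)]
  deg : ∀ X Y, ZMod 2 → Submodule S (Hom X Y)
  isInternal : ∀ X Y, DirectSum.IsInternal (deg X Y)

attribute [instance] GradedQuiver.addCommGroup GradedQuiver.module

namespace GradedQuiver

variable {S : Type u} [CommRing S] {Ob : Type v} (Q : GradedQuiver.{u, v, w} S Ob)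

/-- Homogeneous morphisms, together with a degree. -/
abbrev Homog (X Y : Ob) : Type w := Σ t : ZMod 2, Q.deg X Y t

variable {Q}

/-- The sequence of morphisms underlying a sequence of homogeneous morphisms. -/
def forget {X Y : Ob} {d : ℕ} (p : Chain Q.Homog X Y d) : Chain Q.Hom X Y d :=
  p.map (H' := Q.Hom) (fun Z => Z) fun a => a.2.1

/-- The total reduced degree `∑ (|a_i| - 1)` in `ℤ/2` of a sequence of homogeneous morphisms. -/
def reducedDegree : {X Y : Ob} → {d : ℕ} → Chain Q.Homog X Y d → ZMod 2
  | _, _, _, .nil _ => 0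
  | _, _, _, .cons p a => reducedDegree p + (a.1 - 1)

end GradedQuiver

section Cohomology

variable {S : Type u} [CommRing S] {N : Type v} [AddCommGroup N] [Module S N]

/-- Cocycles of degree `i`. -/
abbrev Cocycles (deg : ZMod 2 → Submodule S N) (δ : N →ₗ[S] N) (i : ZMod 2) : Submodule S N :=
  deg i ⊓ LinearMap.ker δ

/-- Degree `i` cohomology: cocycles of degree `i` modulo the image of the elements of degree
`i - 1`. -/
abbrev Cohomology (deg : ZMod 2 → Submodule S N) (δ : N →ₗ[S] N) (i : ZMod 2) : Type v :=
  Cocycles deg δ i ⧸ ((deg (i - 1)).map δ).submoduleOf (Cocycles deg δ i)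

end Cohomology

/-! ## `A_∞`-categories -/

/-- The sign `(-1)^s`, for `s ∈ ℤ/2`. -/
def sign (s : ZMod 2) : ℤ := (-1) ^ s.val

/-- A (cohomologically unital, uncurved) `ℤ/2`-graded `A_∞`-category over `K` with object set `Ob`.
The operation `μ^d` is the restriction of `μ` to sequences of length `d`. -/
structure AInftyCategory (K : Type u) [Field K] (Ob : Type v) extends
    GradedQuiver.{u, v, w} K Ob where
  μ : ∀ {X Y : Ob} {d : ℕ}, Chain Hom X Y d → Hom X Y
  /-- There is no curvature term. -/
  μ_nil : ∀ X : Ob, μ (Chain.nil X) = 0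
  /-- `μ` is additive in each entry. -/
  μ_add : ∀ {X Y Z W : Ob} {d e : ℕ} (p : Chain Hom X Y d) (a b : Hom Y Z) (q : Chain Hom Z W e),
    μ ((p.cons (a + b)).comp q) = μ ((p.cons a).comp q) + μ ((p.cons b).comp q)
  /-- `μ` is `K`-homogeneous in each entry. -/
  μ_smul : ∀ {X Y Z W : Ob} {d e : ℕ} (p : Chain Hom X Y d) (c : K) (a : Hom Y Z)
    (q : Chain Hom Z W e), μ ((p.cons (c • a)).comp q) = c • μ ((p.cons a).comp q)
  /-- `μ^d` has degree `2 - d`: its value has degree `∑ |a_i| + 2 - d`, which in `ℤ/2` is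
  `∑ (|a_i| - 1)`. -/
  μ_mem : ∀ {X Y : Ob} {d : ℕ} (p : Chain toGradedQuiver.Homog X Y d),
    μ (GradedQuiver.forget p) ∈ deg X Y (GradedQuiver.reducedDegree p)
  /-- The `A_∞`-relations: over all ways of cutting a sequence of homogeneous morphisms into three
  consecutive pieces, the sum of
  `(-1)^✠_n μ (a_k, …, a_{n+m+1}, μ (a_{n+m}, …, a_{n+1}), a_n, …, a_1)` vanishes, where
  `✠_n = ∑_{j ≤ n} |a_j| - n`.  (The terms with `m = 0` are zero, by `μ_nil`.) -/
  relation : ∀ {X Y : Ob} {d : ℕ} (p : Chain toGradedQuiver.Homog X Y d),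
    (p.splits.flatMap fun s => s.fst.splits.map fun t =>
      sign (GradedQuiver.reducedDegree t.fst) •
        μ (((GradedQuiver.forget t.fst).cons (μ (GradedQuiver.forget t.snd))).comp
          (GradedQuiver.forget s.snd))).sum = 0
  /-- A cocycle representing the cohomological unit `[e_X]`. -/
  unit : ∀ X : Ob, Hom X X
  unit_mem : ∀ X : Ob, unit X ∈ deg X X 0
  unit_closed : ∀ X : Ob, μ ((Chain.nil X).cons (unit X)) = 0
  /-- `[μ² (a, e_X)] = [a]`. -/
  unit_right : ∀ {X Y : Ob} (i : ZMod 2) (a : Hom X Y), a ∈ deg X Y i →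
    μ ((Chain.nil X).cons a) = 0 →
    ∃ b ∈ deg X Y (i - 1),
      μ (((Chain.nil X).cons (unit X)).cons a) - a = μ ((Chain.nil X).cons b)
  /-- `(-1)^{|a|} [μ² (e_Y, a)] = [a]`. -/
  unit_left : ∀ {X Y : Ob} (i : ZMod 2) (a : Hom X Y), a ∈ deg X Y i →
    μ ((Chain.nil X).cons a) = 0 →
    ∃ b ∈ deg X Y (i - 1),
      sign i • μ (((Chain.nil X).cons a).cons (unit Y)) - a = μ ((Chain.nil X).cons b)

namespace AInftyCategory

variable {K : Type u} [Field K] {Ob : Type v} (A : AInftyCategory.{u, v, w} K Ob)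

/-- The differential `μ¹`. -/
def differential (X Y : Ob) : A.Hom X Y →ₗ[K] A.Hom X Y where
  toFun a := A.μ ((Chain.nil X).cons a)
  map_add' a b := A.μ_add (Chain.nil X) a b (Chain.nil Y)
  map_smul' c a := A.μ_smul (Chain.nil X) c a (Chain.nil Y)

/-- `H^i(hom_A(X, Y))`. -/
abbrev H (i : ZMod 2) (X Y : Ob) : Type w := Cohomology (A.deg X Y) (A.differential X Y) i

/-- The class `[e_X] ∈ H⁰(hom_A(X, X))`. -/
def unitClass (X : Ob) : A.H 0 X X :=
  Submodule.Quotient.mk ⟨A.unit X, A.unit_mem X, A.unit_closed X⟩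

/-- `X` is simple: `H⁰(hom_A(X, X))` is one-dimensional, that is, equal to `K`. -/
def IsSimple (X : Ob) : Prop := Module.finrank K (A.H 0 X X) = 1

theorem differential_mem {X Y : Ob} {i : ZMod 2} {a : A.Hom X Y} (ha : a ∈ A.deg X Y i) :
    A.differential X Y a ∈ A.deg X Y (i - 1) := by
  have := A.μ_mem ((Chain.nil X).cons (⟨i, a, ha⟩ : A.toGradedQuiver.Homog X Y))
  simp only [GradedQuiver.forget, Chain.map, GradedQuiver.reducedDegree, zero_add] at this
  exact this

theorem differential_sq_of_mem {X Y : Ob} {i : ZMod 2} {a : A.Hom X Y} (ha : a ∈ A.deg X Y i) :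
    A.differential X Y (A.differential X Y a) = 0 := by
  have h := A.relation ((Chain.nil X).cons (⟨i, a, ha⟩ : A.toGradedQuiver.Homog X Y))
  have h0 : ∀ Z W : Ob, ∀ b : A.Hom Z W,
      A.μ (((Chain.nil Z).cons (0 : A.Hom Z Z)).cons b) = 0 := by
    intro Z W b
    have := A.μ_smul (Chain.nil Z) (0 : K) (0 : A.Hom Z Z) ((Chain.nil Z).cons b)
    simpa [Chain.comp] using this
  have h1 : ∀ Z W : Ob, ∀ b : A.Hom Z W,
      A.μ (((Chain.nil Z).cons b).cons (0 : A.Hom W W)) = 0 := by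
    intro Z W b
    have := A.μ_smul ((Chain.nil Z).cons b) (0 : K) (0 : A.Hom W W) (Chain.nil W)
    simpa [Chain.comp] using this
  simp only [Chain.splits, GradedQuiver.forget, Chain.map, Chain.comp, GradedQuiver.reducedDegree,
    List.map_cons, List.map_nil, List.flatMap_cons, List.flatMap_nil, List.cons_append,
    List.nil_append, List.sum_cons, List.sum_nil, A.μ_nil, h0, h1, smul_zero, sign,
    ZMod.val_zero, pow_zero, one_smul, add_zero, zero_add] at h
  exact h

end AInftyCategory

/-! ## Coordinate rings of `𝔾_m` and its powers -/

section CoordRing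

variable (K : Type u) [Field K]

/-- `K[𝔾_m^d]`, the ring of Laurent polynomials in `d` variables `T_1, …, T_d`. -/
def CoordRing (d : ℕ) : Type u := AddMonoidAlgebra K (Fin d → ℤ)

instance (d : ℕ) : CommRing (CoordRing K d) :=
  inferInstanceAs (CommRing (AddMonoidAlgebra K (Fin d → ℤ)))

instance (d : ℕ) : Algebra K (CoordRing K d) :=
  inferInstanceAs (Algebra K (AddMonoidAlgebra K (Fin d → ℤ)))

/-- The map `K[𝔾_m] → K[𝔾_m^d]` dual to the total multiplication: `T ↦ T_1 ⋯ T_d`. -/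
def totalMul (d : ℕ) : K[T;T⁻¹] →ₐ[K] CoordRing K d :=
  AddMonoidAlgebra.mapDomainAlgHom K K
    (⟨⟨fun n _ => n, rfl⟩, fun _ _ => rfl⟩ : ℤ →+ (Fin d → ℤ))

/-- The map `K[𝔾_m] → K[𝔾_m^d]` dual to the `i`-th projection: `T ↦ T_i`. -/
def coordIncl {d : ℕ} (i : Fin d) : K[T;T⁻¹] →ₐ[K] CoordRing K d :=
  AddMonoidAlgebra.mapDomainAlgHom K K (AddMonoidHom.single (fun _ : Fin d => ℤ) i)

/-- `K[𝔾_m^d]` is regarded as a `K[𝔾_m]`-algebra through the total multiplication. -/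
instance (d : ℕ) : Algebra K[T;T⁻¹] (CoordRing K d) := (totalMul K d).toRingHom.toAlgebra

variable {K}

/-- Evaluation `K[𝔾_m] → K` at `g`. -/
def evalAt (g : Kˣ) : K[T;T⁻¹] →+* K := LaurentPolynomial.eval₂ (RingHom.id K) g

/-- Evaluation `K[𝔾_m^d] → K` at `(g_1, …, g_d)`. -/
def evalMulti {d : ℕ} (g : Fin d → Kˣ) : CoordRing K d →ₐ[K] K :=
  AddMonoidAlgebra.lift K K (Fin d → ℤ)
    { toFun := fun n => ((∏ i, g i ^ (n.toAdd i) : Kˣ) : K)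
      map_one' := by simp
      map_mul' := fun m n => by simp [zpow_add, Finset.prod_mul_distrib] }

/-- The automorphism of `K[𝔾_m]` dual to multiplication by `c` on `𝔾_m`: `T ↦ c T`. -/
def translation (c : Kˣ) : K[T;T⁻¹] →+* K[T;T⁻¹] :=
  LaurentPolynomial.eval₂ LaurentPolynomial.C
    (Units.map (LaurentPolynomial.C : K →+* K[T;T⁻¹]).toMonoidHom c *
      (LaurentPolynomial.isUnit_T 1).unit)

theorem laurent_ringHom_ext {S : Type v} [CommRing S] {f f' : K[T;T⁻¹] →+* S}
    (hC : ∀ c, f (.C c) = f' (.C c)) (hT : ∀ n, f (.T n) = f' (.T n)) : f = f' := by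
  refine RingHom.ext fun x => ?_
  induction x using LaurentPolynomial.induction_on' with
  | add p q hp hq => simp [hp, hq]
  | C_mul_T n a => simp [hC, hT]

theorem algebraMap_T (d : ℕ) (n : ℤ) :
    algebraMap K[T;T⁻¹] (CoordRing K d) (.T n) = (AddMonoidAlgebra.single (fun _ => n) 1 :
      AddMonoidAlgebra K (Fin d → ℤ)) := by
  change AddMonoidAlgebra.mapDomainAlgHom K K _ (AddMonoidAlgebra.single n 1) = _
  exact AddMonoidAlgebra.mapDomain_single

theorem evalMulti_single {d : ℕ} (g : Fin d → Kˣ) (n : Fin d → ℤ) (c : K) :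
    evalMulti g (AddMonoidAlgebra.single n c : AddMonoidAlgebra K (Fin d → ℤ)) =
      c * ((∏ i, g i ^ (n i) : Kˣ) : K) := by
  exact (AddMonoidAlgebra.lift_single _ _ _).trans (smul_eq_mul _ _)

theorem evalMulti_algebraMap {d : ℕ} (g : Fin d → Kˣ) (f : K[T;T⁻¹]) :
    evalMulti g (algebraMap K[T;T⁻¹] (CoordRing K d) f) = evalAt (∏ i, g i) f := by
  suffices h : (evalMulti g).toRingHom.comp (algebraMap K[T;T⁻¹] (CoordRing K d)) =
      evalAt (∏ i, g i) from DFunLike.congr_fun h f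
  apply laurent_ringHom_ext
  · intro c
    change evalMulti g (totalMul K d (algebraMap K _ c)) = _
    rw [AlgHom.commutes, AlgHom.commutes]
    simp [evalAt]
  · intro n
    change evalMulti g (algebraMap K[T;T⁻¹] (CoordRing K d) (.T n)) = _
    rw [algebraMap_T, evalMulti_single]
    simp [evalAt, Finset.prod_zpow]

/-- The identification `K[𝔾_m^1] ≃ K[𝔾_m]`, as a map of `K[𝔾_m]`-modules. -/
def coordOne : CoordRing K 1 →ₗ[K[T;T⁻¹]] K[T;T⁻¹] :=
  let φ : AddMonoidAlgebra K (Fin 1 → ℤ) →ₐ[K] AddMonoidAlgebra K ℤ :=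
    AddMonoidAlgebra.mapDomainAlgHom K K (Pi.evalAddMonoidHom (fun _ : Fin 1 => ℤ) 0)
  have hφ : (φ.toRingHom.comp (totalMul K 1).toRingHom : K[T;T⁻¹] →+* K[T;T⁻¹]) =
      RingHom.id _ := by
    apply laurent_ringHom_ext
    · intro c
      change φ (totalMul K 1 (algebraMap K _ c)) = _
      rw [AlgHom.commutes]
      exact AlgHom.commutes _ _
    · intro n
      change φ (algebraMap K[T;T⁻¹] (CoordRing K 1) (.T n)) = _
      rw [algebraMap_T]
      exact AddMonoidAlgebra.mapDomain_single
  { toFun := fun x => φ x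
    map_add' := fun x y => map_add φ x y
    map_smul' := fun f x => by
      change φ (totalMul K 1 f * x) = f * φ x
      exact (map_mul φ _ _).trans (congrArg (· * φ x) (DFunLike.congr_fun hφ f)) }

theorem evalAt_coordOne (g : Fin 1 → Kˣ) (x : CoordRing K 1) :
    evalAt (g 0) (coordOne x) = evalMulti g x := by
  refine AddMonoidAlgebra.induction_linear (motive := fun x : AddMonoidAlgebra K (Fin 1 → ℤ) =>
    evalAt (g 0) (coordOne (K := K) x) = evalMulti g x) x ?_ ?_ ?_
  · change evalAt (g 0) (coordOne (0 : CoordRing K 1)) = evalMulti g (0 : CoordRing K 1)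
    simp
  · intro p q hp hq
    have h : ∀ p q : CoordRing K 1, evalAt (g 0) (coordOne p) = evalMulti g p →
        evalAt (g 0) (coordOne q) = evalMulti g q →
        evalAt (g 0) (coordOne (p + q)) = evalMulti g (p + q) := by
      intro p q hp hq
      rw [map_add, map_add, map_add, hp, hq]
    exact h p q hp hq
  · intro n c
    rw [evalMulti_single]
    have : coordOne (K := K) (AddMonoidAlgebra.single n c : AddMonoidAlgebra K (Fin 1 → ℤ)) =
      AddMonoidAlgebra.single (n 0) c := AddMonoidAlgebra.mapDomain_single
    rw [this, LaurentPolynomial.single_eq_C_mul_T]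
    simp [evalAt]

end CoordRing

/-! ## Strict and rational `𝔾_m`-actions -/

/-- A strict action of `Kˣ` on an `A_∞`-category: an action on objects, together with compatible
graded linear maps on morphism spaces which respect all the `A_∞`-operations on the nose. -/
structure StrictAction {K : Type u} [Field K] {Ob : Type v} [MulAction Kˣ Ob]
    (A : AInftyCategory.{u, v, w} K Ob) where
  act : ∀ (g : Kˣ) {X Y : Ob}, A.Hom X Y →ₗ[K] A.Hom (g • X) (g • Y)
  act_mem : ∀ (g : Kˣ) {X Y : Ob} (i : ZMod 2) (a : A.Hom X Y), a ∈ A.deg X Y i →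
    act g a ∈ A.deg (g • X) (g • Y) i
  act_one : ∀ {X Y : Ob} (a : A.Hom X Y), HEq (act 1 a) a
  act_mul : ∀ (g h : Kˣ) {X Y : Ob} (a : A.Hom X Y), HEq (act (g * h) a) (act g (act h a))
  act_μ : ∀ (g : Kˣ) {X Y : Ob} {d : ℕ} (p : Chain A.Hom X Y d),
    act g (A.μ p) = A.μ (p.map (H' := A.Hom) (fun Z => g • Z) fun a => act g a)

/-- The object `g_d • (⋯ • (g_1 • X))`. -/
def iterSMul {G : Type u} {Ob : Type v} [SMul G Ob] : {d : ℕ} → (Fin d → G) → Ob → Ob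
  | 0, _, X => X
  | d + 1, g, X => g (Fin.last d) • iterSMul (Fin.init g) X

theorem iterSMul_eq {G : Type u} [CommGroup G] {Ob : Type v} [MulAction G Ob] {d : ℕ}
    (g : Fin d → G) (X : Ob) : iterSMul g X = (∏ i, g i) • X := by
  induction d with
  | zero => simp [iterSMul]
  | succ d ih =>
    rw [iterSMul, ih, Fin.prod_univ_castSucc, mul_comm, mul_smul]
    rfl

/-- Over `𝔾_m`, a family of morphism modules with the same objects as `A`: graded
`K[𝔾_m]`-modules `Hom X Y`, operations taking values in `K[𝔾_m^d] ⊗_{K[𝔾_m]} Hom X Y`, and, for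
`g ∈ Kˣ`, maps `ev g` from `Hom X Y` to `hom_A(g X, Y)`, semilinear over the evaluation
`K[𝔾_m] → K` at `g`. -/
structure EquivariantFamily {K : Type u} [Field K] {Ob : Type v} [MulAction Kˣ Ob]
    (A : AInftyCategory.{u, v, w} K Ob) extends GradedQuiver.{u, v, u'} K[T;T⁻¹] Ob where
  μ : ∀ {X Y : Ob} {d : ℕ}, Chain Hom X Y d → CoordRing K d ⊗[K[T;T⁻¹]] Hom X Y
  ev : ∀ (g : Kˣ) {X Y : Ob}, Hom X Y →ₛₗ[evalAt g] A.Hom (g • X) Y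

namespace EquivariantFamily

variable {K : Type u} [Field K] {Ob : Type v} [MulAction Kˣ Ob]
  {A : AInftyCategory.{u, v, w} K Ob} (F : EquivariantFamily.{u, v, w, u'} A)

/-- The value `a_g ∈ hom_A(S, Y)` of `a ∈ hom(X, Y)` at `g`, where `S` is (equal to) `g X`. -/
def value (g : Kˣ) {S X Y : Ob} (h : S = g • X) : F.Hom X Y →ₛₗ[evalAt g] A.Hom S Y :=
  h ▸ F.ev g

/-- The value at `(g_1, …, g_d)` of an element of `K[𝔾_m^d] ⊗ hom(X, Y)`; it lies in
`hom_A(S, Y)`, where `S` is (equal to) `g_1 ⋯ g_d X`. -/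
def multiValue {d : ℕ} (g : Fin d → Kˣ) {S X Y : Ob} (h : S = (∏ i, g i) • X) :
    CoordRing K d ⊗[K[T;T⁻¹]] F.Hom X Y →+ A.Hom S Y :=
  TensorProduct.liftAddHom
    { toFun := fun b =>
        { toFun := fun a => evalMulti g b • F.value (∏ i, g i) h a
          map_zero' := by simp
          map_add' := by simp }
      map_zero' := by ext; simp
      map_add' := fun b b' => by ext; simp [add_smul] }
    (fun r b a => by
      simp [Algebra.smul_def, evalMulti_algebraMap, mul_smul, smul_comm (evalMulti g b)])

/-- The composable sequence in `A` given by the values of `(a_d, …, a_1)` at `(g_d, …, g_1)`: its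
entries are `(a_d)_{g_d}`, `g_d · (a_{d-1})_{g_{d-1}}`, …, `(g_d ⋯ g_2) · (a_1)_{g_1}`. -/
def chainValue (σ : StrictAction A) : {X Y : Ob} → {d : ℕ} → Chain F.Hom X Y d →
    (g : Fin d → Kˣ) → Chain A.Hom (iterSMul g X) Y d
  | X, _, _, .nil _, _ => .nil X
  | _, _, d + 1, .cons p a, g =>
    .cons ((chainValue σ p (Fin.init g)).map (H' := A.Hom) (fun Z => g (Fin.last d) • Z)
      fun b => σ.act (g (Fin.last d)) b) (F.ev (g (Fin.last d)) a)

end EquivariantFamily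

/-- A rational `𝔾_m`-action on `A`, with `𝔾_m` acting freely on objects and strictly on morphisms,
given by a category `family` over `𝔾_m`.

The fields `family_mu` and `translate_ev` say that `family` specialises at all points of `Kˣ` to
`A`.  When `K` is infinite, an element of a projective module over `K[𝔾_m^d]` is determined by its
values at the points of `(Kˣ)^d`; hence the `A_∞`-relations and the unitality of `family` are those
of `A`, and the compatibility of the operations of `family` with `translate` is that of the
operations of `A` with the strict action. -/
structure RationalAction {K : Type u} [Field K] {Ob : Type v} [MulAction Kˣ Ob]
    (A : AInftyCategory.{u, v, w} K Ob) where
  strict : StrictAction A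
  free : ∀ (g : Kˣ) (X : Ob), g • X = X → g = 1
  family : EquivariantFamily.{u, v, w, u'} A
  projective : ∀ X Y : Ob, Module.Projective K[T;T⁻¹] (family.Hom X Y)
  /-- `ev g` identifies the fibre at `g` of each graded piece of `family.Hom X Y` with the same
  graded piece of `hom_A(g X, Y)`: it maps onto the latter, with kernel `(T - g) Hom X Y`. -/
  ev_mem : ∀ (g : Kˣ) {X Y : Ob} (i : ZMod 2) (a : family.Hom X Y), a ∈ family.deg X Y i →
    family.ev g a ∈ A.deg (g • X) Y i
  ev_surjective : ∀ (g : Kˣ) {X Y : Ob} (i : ZMod 2) (b : A.Hom (g • X) Y),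
    b ∈ A.deg (g • X) Y i → ∃ a ∈ family.deg X Y i, family.ev g a = b
  ev_kernel : ∀ (g : Kˣ) {X Y : Ob} (i : ZMod 2) (a : family.Hom X Y), a ∈ family.deg X Y i →
    family.ev g a = 0 →
    ∃ b ∈ family.deg X Y i, a = (LaurentPolynomial.T 1 - LaurentPolynomial.C (g : K)) • b
  μ_nil : ∀ X : Ob, family.μ (Chain.nil X) = 0
  /-- The operations are `K[𝔾_m^d]`-linear maps on
  `hom(X_{d-1}, X_d) ⊗_K ⋯ ⊗_K hom(X_0, X_1)`. -/
  μ_add : ∀ {X Y Z W : Ob} {d e : ℕ} (p : Chain family.Hom X Y d) (a b : family.Hom Y Z)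
    (q : Chain family.Hom Z W e),
    family.μ ((p.cons (a + b)).comp q) = family.μ ((p.cons a).comp q) + family.μ ((p.cons b).comp q)
  μ_smul : ∀ {X Y Z W : Ob} {d e : ℕ} (p : Chain family.Hom X Y d) (f : K[T;T⁻¹])
    (a : family.Hom Y Z) (q : Chain family.Hom Z W e),
    family.μ ((p.cons (f • a)).comp q) =
      coordIncl K (⟨d, by omega⟩ : Fin (d + 1 + e)) f • family.μ ((p.cons a).comp q)
  /-- `μ^d` has degree `2 - d`. -/
  μ_mem : ∀ {X Y : Ob} {d : ℕ} (p : Chain family.Homog X Y d),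
    family.μ (GradedQuiver.forget p) ∈ LinearMap.range (LinearMap.lTensor (CoordRing K d)
      (family.deg X Y (GradedQuiver.reducedDegree p)).subtype)
  /-- Fibrewise, the operations are those of `A`. -/
  family_mu : ∀ {X Y : Ob} {d : ℕ} (p : Chain family.Hom X Y d) (g : Fin d → Kˣ),
    family.multiValue g (iterSMul_eq g X) (family.μ p) = A.μ (family.chainValue strict p g)
  /-- `hom(g_0 X_0, g_1 X_1)` is the pullback of `hom(X_0, X_1)` under multiplication by
  `g_1⁻¹ g_0`, compatibly with the identification of `hom_A(g g_0 X_0, g_1 X_1)` with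
  `hom_A(g_1⁻¹ g g_0 X_0, X_1)` by the strict action of `g_1`. -/
  translate : ∀ (g₀ g₁ : Kˣ) (X Y : Ob), family.Hom X Y ≃+ family.Hom (g₀ • X) (g₁ • Y)
  translate_smul : ∀ (g₀ g₁ : Kˣ) (X Y : Ob) (f : K[T;T⁻¹]) (a : family.Hom X Y),
    translate g₀ g₁ X Y (f • a) = translation (g₁⁻¹ * g₀) f • translate g₀ g₁ X Y a
  translate_mem : ∀ (g₀ g₁ : Kˣ) (X Y : Ob) (i : ZMod 2) (a : family.Hom X Y),
    a ∈ family.deg X Y i → translate g₀ g₁ X Y a ∈ family.deg (g₀ • X) (g₁ • Y) i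
  translate_ev : ∀ (g g₀ g₁ : Kˣ) (X Y : Ob) (a : family.Hom X Y),
    HEq (family.ev g (translate g₀ g₁ X Y a)) (strict.act g₁ (family.ev (g₁⁻¹ * g * g₀) a))

namespace RationalAction

variable {K : Type u} [Field K] {Ob : Type v} [MulAction Kˣ Ob]
  {A : AInftyCategory.{u, v, w} K Ob} (R : RationalAction.{u, v, w, u'} A)

/-- The differential `μ¹` of `family`, using `K[𝔾_m^1] = K[𝔾_m]`. -/
def differential (X Y : Ob) : R.family.Hom X Y →ₗ[K[T;T⁻¹]] R.family.Hom X Y where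
  toFun a := TensorProduct.lid _ _
    (LinearMap.rTensor _ coordOne (R.family.μ ((Chain.nil X).cons a)))
  map_add' a b := by
    have := R.μ_add (Chain.nil X) a b (Chain.nil Y)
    simp only [Chain.comp] at this
    rw [this, map_add, map_add]
  map_smul' f a := by
    have := R.μ_smul (Chain.nil X) f a (Chain.nil Y)
    simp only [Chain.comp] at this
    have h : ∀ x : CoordRing K 1 ⊗[K[T;T⁻¹]] R.family.Hom X Y,
        coordIncl K (⟨0, by omega⟩ : Fin (0 + 1 + 0)) f • x = f • x := by
      have hf : coordIncl K (⟨0, by omega⟩ : Fin (0 + 1 + 0)) f =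
          algebraMap K[T;T⁻¹] (CoordRing K 1) f := by
        suffices hh : (coordIncl K (0 : Fin 1)).toRingHom = (totalMul K 1).toRingHom from
          DFunLike.congr_fun hh f
        apply laurent_ringHom_ext
        · intro c
          exact (AlgHom.commutes (coordIncl K (0 : Fin 1)) c).trans
            (AlgHom.commutes (totalMul K 1) c).symm
        · intro n
          refine (AddMonoidAlgebra.mapDomain_single).trans
            (Eq.trans ?_ (algebraMap_T 1 n).symm)
          congr 1
          ext i
          fin_cases i
          simp
      intro x
      exact (congrArg (· • x) hf).trans (algebraMap_smul _ f x)
    rw [this, h, map_smul, map_smul]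
    rfl

/-- `family` is proper: each `H^i(hom(X, Y))` is a finitely generated `K[𝔾_m]`-module. -/
def IsProper : Prop :=
  ∀ (X Y : Ob) (i : ZMod 2),
    Module.Finite K[T;T⁻¹] (Cohomology (R.family.deg X Y) (R.differential X Y) i)

/-! ### Facts needed for the deformation class -/

theorem value_mem (g : Kˣ) {S X Y : Ob} (h : S = g • X) {i : ZMod 2} {a : R.family.Hom X Y}
    (ha : a ∈ R.family.deg X Y i) : R.family.value g h a ∈ A.deg S Y i := by
  subst h
  exact R.ev_mem g i a ha

theorem value_surjective (g : Kˣ) {S X Y : Ob} (h : S = g • X) {i : ZMod 2} {b : A.Hom S Y}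
    (hb : b ∈ A.deg S Y i) : ∃ a ∈ R.family.deg X Y i, R.family.value g h a = b := by
  subst h
  exact R.ev_surjective g i b hb

theorem value_kernel (g : Kˣ) {S X Y : Ob} (h : S = g • X) {i : ZMod 2} {a : R.family.Hom X Y}
    (ha : a ∈ R.family.deg X Y i) (h0 : R.family.value g h a = 0) :
    ∃ b ∈ R.family.deg X Y i, a = (LaurentPolynomial.T 1 - LaurentPolynomial.C (g : K)) • b := by
  subst h
  exact R.ev_kernel g i a ha h0

theorem differential_mem {X Y : Ob} {i : ZMod 2} {a : R.family.Hom X Y}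
    (ha : a ∈ R.family.deg X Y i) : R.differential X Y a ∈ R.family.deg X Y (i - 1) := by
  have h := R.μ_mem ((Chain.nil X).cons (⟨i, a, ha⟩ : R.family.Homog X Y))
  have key : ∀ (j : ZMod 2) (x : CoordRing K 1 ⊗[K[T;T⁻¹]] R.family.deg X Y j),
      TensorProduct.lid _ _ (LinearMap.rTensor _ coordOne
        (LinearMap.lTensor (CoordRing K 1) (R.family.deg X Y j).subtype x)) ∈
        R.family.deg X Y j := by
    intro j x
    induction x using TensorProduct.induction_on with
    | zero => simp
    | tmul b m => simpa using Submodule.smul_mem _ _ m.2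
    | add x y hx hy =>
      rw [map_add, map_add, map_add]
      exact Submodule.add_mem _ hx hy
  obtain ⟨x, hx⟩ := h
  have hd : R.differential X Y a = TensorProduct.lid _ _ (LinearMap.rTensor _ coordOne
      (LinearMap.lTensor (CoordRing K 1) (R.family.deg X Y (0 + (i - 1))).subtype x)) :=
    congrArg (fun y => TensorProduct.lid _ _ (LinearMap.rTensor _ coordOne y)) hx.symm
  have h3 : R.differential X Y a ∈ R.family.deg X Y (0 + (i - 1)) := by
    rw [hd]
    exact key _ x
  rwa [zero_add] at h3

theorem value_differential (g : Kˣ) {S X Y : Ob} (h : S = g • X) (a : R.family.Hom X Y) :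
    R.family.value g h (R.differential X Y a) = A.differential S Y (R.family.value g h a) := by
  subst h
  have key : ∀ x : CoordRing K 1 ⊗[K[T;T⁻¹]] R.family.Hom X Y,
      ∀ h' : g • X = (∏ i : Fin 1, (fun _ => g) i) • X,
      R.family.multiValue (fun _ : Fin 1 => g) h' x =
        R.family.value g rfl (TensorProduct.lid _ _ (LinearMap.rTensor _ coordOne x)) := by
    intro x h'
    have hv : ∀ (k : Kˣ) (hk : k = g) (hX : g • X = k • X) (m : R.family.Hom X Y),
        R.family.value k hX m = R.family.value g rfl m := by
      intro k hk hX m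
      subst hk
      rfl
    induction x using TensorProduct.induction_on with
    | zero => simp
    | tmul b m =>
      have he := evalAt_coordOne (fun _ : Fin 1 => g) b
      simp only [LinearMap.rTensor_tmul, TensorProduct.lid_tmul, map_smulₛₗ, he]
      change evalMulti (fun _ => g) b • R.family.value _ h' m = _
      rw [hv _ (by simp) h' m]
    | add x y hx hy =>
      rw [map_add, map_add, map_add, map_add, hx, hy]
  refine (key _ (by simp)).symm.trans ?_
  exact R.family_mu ((Chain.nil X).cons a) (fun _ => g)

theorem laurent_eq_zero [Infinite K] (f : K[T;T⁻¹]) (h : ∀ g : Kˣ, evalAt g f = 0) : f = 0 := by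
  obtain ⟨n, p, hp⟩ := LaurentPolynomial.exists_T_pow f
  have hp0 : p = 0 := by
    by_contra hne
    have hsub : ({0}ᶜ : Set K) ⊆ {x | p.IsRoot x} := by
      intro x hx
      have h1 := congrArg (evalAt (Units.mk0 x hx)) hp
      rw [map_mul, h, zero_mul] at h1
      rw [evalAt, LaurentPolynomial.eval₂_toLaurent] at h1
      have h2 : Polynomial.eval ((Units.mk0 x hx : Kˣ) : K) p = 0 := by simpa using h1
      exact h2
    exact ((Set.finite_singleton (0 : K)).infinite_compl.mono hsub)
      (Polynomial.finite_setOfPred_isRoot hne)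
  have hT := LaurentPolynomial.isUnit_T (R := K) n
  rw [hp0, map_zero] at hp
  exact (hT.mul_left_eq_zero).mp hp.symm

theorem coordinates {X Y : Ob} : ∃ s : R.family.Hom X Y →ₗ[K[T;T⁻¹]] R.family.Hom X Y →₀ K[T;T⁻¹],
    Function.Injective s := by
  have := R.projective X Y
  obtain ⟨s, hs⟩ := (Module.projective_def (R := K[T;T⁻¹]) (P := R.family.Hom X Y)).mp this
  exact ⟨s, hs.injective⟩

/-- A homogeneous morphism all of whose values vanish is zero. -/
theorem eq_zero_of_ev [Infinite K] {X Y : Ob} {i : ZMod 2} {a : R.family.Hom X Y}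
    (ha : a ∈ R.family.deg X Y i) (h : ∀ g : Kˣ, R.family.ev g a = 0) : a = 0 := by
  obtain ⟨s, hs⟩ := R.coordinates (X := X) (Y := Y)
  apply hs
  rw [map_zero]
  ext1 m
  apply laurent_eq_zero
  intro g
  obtain ⟨b, -, hb⟩ := R.ev_kernel g i a ha (h g)
  rw [hb]
  simp [evalAt]

theorem differential_sq_of_mem [Infinite K] {X Y : Ob} {i : ZMod 2} {a : R.family.Hom X Y}
    (ha : a ∈ R.family.deg X Y i) : R.differential X Y (R.differential X Y a) = 0 := by
  refine R.eq_zero_of_ev (R.differential_mem (R.differential_mem ha)) fun g => ?_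
  have hv : ∀ c : R.family.Hom X Y, R.family.ev g c = R.family.value g rfl c := fun c => rfl
  rw [hv, value_differential, value_differential, A.differential_sq_of_mem (R.value_mem g rfl ha)]

theorem smul_cancel {X Y : Ob} {f : K[T;T⁻¹]} (hf : f ≠ 0) {a : R.family.Hom X Y}
    (h : f • a = 0) : a = 0 := by
  obtain ⟨s, hs⟩ := R.coordinates (X := X) (Y := Y)
  apply hs
  rw [map_zero]
  ext1 m
  have h1 : f * s a m = 0 := by
    have := DFunLike.congr_fun (congrArg s h) m
    simpa using this
  exact (mul_eq_zero.mp h1).resolve_left hf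

theorem T_sub_one_ne_zero : (LaurentPolynomial.T 1 - 1 : K[T;T⁻¹]) ≠ 0 := by
  intro h
  have : (Polynomial.X - 1 : Polynomial K) = 0 := by
    apply Polynomial.toLaurent_injective
    simpa using h
  exact Polynomial.X_sub_C_ne_zero (1 : K) (by simpa using this)

theorem value_one_smul {X : Ob} (h : X = (1 : Kˣ) • X) (a : R.family.Hom X X) :
    R.family.value 1 h ((LaurentPolynomial.T 1 - 1 : K[T;T⁻¹]) • a) = 0 := by
  rw [map_smulₛₗ]
  simp [evalAt]

end RationalAction

/-! ## Infinitesimal equivariance -/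

section Cotangent

variable (K : Type u) [Field K]

/-- The maximal ideal `I_e` of `K[𝔾_m]` at the point `e = 1`. -/
def idealOne : Ideal K[T;T⁻¹] := RingHom.ker (evalAt (1 : Kˣ))

/-- `𝔤^∨ = I_e / I_e²`, the dual of the Lie algebra of `𝔾_m`. -/
abbrev LieDual : Type u := (idealOne K).Cotangent

/-- The class of `T - 1` in `𝔤^∨`. -/
def dT : LieDual K :=
  (idealOne K).toCotangent ⟨LaurentPolynomial.T 1 - 1, by simp [idealOne, RingHom.mem_ker, evalAt]⟩

end Cotangent

namespace RationalAction

variable {K : Type u} [Field K] {Ob : Type v} [MulAction Kˣ Ob]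
  {A : AInftyCategory.{u, v, w} K Ob} (R : RationalAction.{u, v, w, u'} A)

/-- `(a, z)` computes the connecting morphism on `[e_X]`: `a` lifts the cocycle `e_X` from the
fibre at `e` to `hom(X, X)`, and `μ¹ a = (T - 1) z`. -/
structure IsLift (X : Ob) (a z : R.family.Hom X X) : Prop where
  left_mem : a ∈ R.family.deg X X 0
  right_mem : z ∈ R.family.deg X X 1
  value_left : R.family.value 1 (one_smul Kˣ X).symm a = A.unit X
  differential_left : R.differential X X a = (LaurentPolynomial.T 1 - 1 : K[T;T⁻¹]) • z

theorem exists_isLift (X : Ob) : ∃ az : R.family.Hom X X × R.family.Hom X X,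
    R.IsLift X az.1 az.2 := by
  obtain ⟨a, ha, hav⟩ := R.value_surjective 1 (one_smul Kˣ X).symm (A.unit_mem X)
  have h0 : R.family.value 1 (one_smul Kˣ X).symm (R.differential X X a) = 0 := by
    rw [value_differential, hav]
    exact A.unit_closed X
  obtain ⟨z, hz, hz'⟩ := R.value_kernel 1 _ (R.differential_mem ha) h0
  exact ⟨(a, z), ha, by simpa using hz, hav, by simpa using hz'⟩

variable [Infinite K]

theorem IsLift.value_mem_cocycles {R : RationalAction.{u, v, w, u'} A} {X : Ob}
    {a z : R.family.Hom X X} (h : R.IsLift X a z) :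
    R.family.value 1 (one_smul Kˣ X).symm z ∈ Cocycles (A.deg X X) (A.differential X X) 1 := by
  refine ⟨R.value_mem 1 _ h.right_mem, ?_⟩
  have h1 := R.differential_sq_of_mem h.left_mem
  rw [h.differential_left, map_smul] at h1
  have h2 := R.smul_cancel T_sub_one_ne_zero h1
  change A.differential X X _ = 0
  rw [← value_differential, h2, map_zero]

/-- The deformation class `Def⁰_X ∈ 𝔤^∨ ⊗ H¹(hom_A(X, X))`: the image of `[e_X]` under the
connecting morphism of the short exact sequence of complexes
`0 → 𝔤^∨ ⊗ hom(X, X) → K[𝔾_m]/I_e² ⊗ hom(X, X) → K ⊗ hom(X, X) → 0`,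
where all tensor products are over `K[𝔾_m]`.  That is: lift `e_X` to `hom(X, X)`, apply `μ¹`, write
the result as `(T - 1) z`, and take the class of `dT ⊗ z`, where
`𝔤^∨ ⊗_{K[𝔾_m]} hom(X, X) = 𝔤^∨ ⊗_K hom_A(X, X)` by passing to the value of `z` at `e`. -/
def deformationClass (X : Ob) : LieDual K ⊗[K] A.H 1 X X :=
  dT K ⊗ₜ[K] Submodule.Quotient.mk
    ⟨_, (Classical.choose_spec (R.exists_isLift X)).value_mem_cocycles⟩

/-- The deformation class does not depend on the choice of lifts. -/
theorem deformationClass_eq {X : Ob} {a z : R.family.Hom X X} (h : R.IsLift X a z) :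
    R.deformationClass X = dT K ⊗ₜ[K] Submodule.Quotient.mk ⟨_, h.value_mem_cocycles⟩ := by
  have h' := Classical.choose_spec (R.exists_isLift X)
  unfold deformationClass
  congr 1
  rw [Submodule.Quotient.eq]
  set a' := (Classical.choose (R.exists_isLift X)).1
  set z' := (Classical.choose (R.exists_isLift X)).2
  obtain ⟨w, hw, hw'⟩ := R.value_kernel 1 (one_smul Kˣ X).symm
    (Submodule.sub_mem _ h'.left_mem h.left_mem) (by rw [map_sub, h'.value_left, h.value_left, sub_self])
  have e1 : (LaurentPolynomial.T 1 - 1 : K[T;T⁻¹]) • (z' - z - R.differential X X w) = 0 := by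
    have := congrArg (R.differential X X) hw'
    rw [map_sub, h'.differential_left, h.differential_left, map_smul] at this
    rw [smul_sub, smul_sub, this]
    simp
  have e2 := R.smul_cancel T_sub_one_ne_zero e1
  refine ⟨R.family.value 1 (one_smul Kˣ X).symm w, ?_, ?_⟩
  · simpa using R.value_mem 1 (one_smul Kˣ X).symm hw
  · rw [← value_differential, ← sub_eq_zero.mp e2, map_sub]
    rfl

/-- `X` is infinitesimally equivariant: `Def⁰_X = 0`. -/
def IsInfinitesimallyEquivariant (X : Ob) : Prop := R.deformationClass X = 0

end RationalAction

/-! ## Weakly equivariant structures -/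

/-- A (rational) weakly `𝔾_m`-equivariant structure on `X`: an element `ρ¹` of
`K[𝔾_m] ⊗_{K[𝔾_m]} hom⁰(X, X) = hom⁰(X, X)` with `[ρ¹_e] = [e_X]`, for which there is
`ρ² ∈ K[𝔾_m²] ⊗_{K[𝔾_m]} hom⁻¹(X, X)` such that, for all `g, g_1, g_2 ∈ Kˣ`,
`μ¹(ρ¹_g) = 0` and `μ²(ρ¹_{g_2}, g_2 · ρ¹_{g_1}) - ρ¹_{g_2 g_1} + μ¹(ρ²_{g_2, g_1}) = 0`. -/
structure WeaklyEquivariantStructure {K : Type u} [Field K] {Ob : Type v} [MulAction Kˣ Ob]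
    {A : AInftyCategory.{u, v, w} K Ob} (R : RationalAction.{u, v, w, u'} A) (X : Ob) where
  rho : R.family.Hom X X
  rho_mem : rho ∈ R.family.deg X X 0
  closed : ∀ g : Kˣ, A.differential (g • X) X (R.family.ev g rho) = 0
  unital : ∃ b ∈ A.deg X X (-1),
    R.family.value 1 (one_smul Kˣ X).symm rho - A.unit X = A.differential X X b
  associative : ∃ rho₂ ∈ LinearMap.range
      (LinearMap.lTensor (CoordRing K 2) (R.family.deg X X (-1)).subtype),
    ∀ g₁ g₂ : Kˣ,
      A.μ (((Chain.nil (g₂ • g₁ • X)).cons (R.strict.act g₂ (R.family.ev g₁ rho))).cons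
          (R.family.ev g₂ rho))
        - R.family.value (g₂ * g₁) (mul_smul g₂ g₁ X).symm rho
        + A.differential (g₂ • g₁ • X) X
            (R.family.multiValue ![g₁, g₂] (by simp [mul_comm g₁ g₂, mul_smul]) rho₂) = 0

end AInfty

end

open scoped TensorProduct LaurentPolynomial

noncomputable section

namespace AInfty

open LaurentPolynomial (T C)

universe u v w u'

/-! ## Laurent polynomials -/

section Laurent

variable {K : Type u} [Field K]

/-! The complexes `hom(gX, X)` form an algebraic family over `𝔾_m`, and sections of it multiply: `b`
at `g₂` and `a` at `g₁` give an element over `g = g₂ g₁`, namely a Laurent polynomial in `z = g₁`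
whose coefficients are sections evaluated at `g`. `OrbitAlgebra` isolates this structure. The task
is to extend the unit, which lives over `1`, to a cocycle `ρ` with `ρ_{g₂} ρ_{g₁}` homotopic to
`ρ_{g₂ g₁}`, the homotopy being algebraic in both parameters.

Extension. Put `τ = T - 1`. Vanishing of the deformation class yields a lift `a` of the unit with `d
a = τ² w`. Because `d a` vanishes to second order at `1`, both right multiplication `ψ` by the value
of `a` at `1` and the derivative `D` at `z = 1` of right multiplication by the values of `a` commute
with `d`. Moreover `ψ` is the identity on cohomology modulo `τ`, and `D` behaves like a connection:
`D(τ^(k+1) m) = τ^(k+1) D m - (k+1) T τ^k ψ m`. By properness the `τ`-power torsion of `H¹` is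
killed by a single power of `τ`, and in characteristic zero this formula lowers that power to `0`
(`mem_boundaries_of_pow_succ`). Since `τ² w = d a` is exact, `w` is exact, and `a` can be corrected
to a cocycle `σ`.

Rank one. On `H⁰`, right multiplication by the value of `σ` at `1` is idempotent, is the identity
modulo `τ`, and kills torsion. Since `X` is simple, its image is free of rank one over the principal
ideal domain `K[𝔾_m]`, with a generator `ρ` that agrees with `σ` modulo `τ` (`exists_generator`).

Rigidity. All coefficients of the product of `ρ` with itself are multiples of `ρ` in cohomology, so
`ρ_x ρ_z = q(x, z) ρ_{xz}` for a Laurent polynomial `q` with `q(x, 1) = 1`. Associativity makes `q`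
a 2-cocycle, and comparing extreme powers of `z` forces `q = 1` (`eq_single_of_cocycle`). Primitives
of the remaining exact coefficients assemble to `ρ²`. -/

@[simp] theorem evalAt_T (g : Kˣ) (n : ℤ) : evalAt g (T n) = ((g ^ n : Kˣ) : K) := by
  simp [evalAt]

@[simp] theorem evalAt_C (g : Kˣ) (c : K) : evalAt g (C c) = c := by
  simp [evalAt]

theorem coeff_sum_C_mul_T {W : Type*} [Zero W] (φ : ℤ → W → K) (hφ : ∀ k, φ k 0 = 0) (n : ℤ →₀ W)
    (k : ℤ) : (n.sum fun k x => C (φ k x) * T k : K[T;T⁻¹]).coeff k = φ k (n k) := by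
  have : ∀ (c : K) (j : ℤ), (C c * T j).coeff k = if j = k then c else 0 := by
    intro c j
    rw [← LaurentPolynomial.single_eq_C_mul_T]
    exact Finsupp.single_apply
  simp only [Finsupp.sum, AddMonoidAlgebra.coeff_sum, Finsupp.finsetSum_apply, this]
  simp +contextual [hφ]

/-- Each ideal of the localisation of `K[X]` at the powers of `X` is extended from an ideal of
`K[X]`, which is principal. Both the Noetherian property and the freeness of finitely generated
torsion-free modules come from here. -/
instance : IsPrincipalIdealRing K[T;T⁻¹] where
  principal I := by
    obtain ⟨p, hp⟩ := IsPrincipalIdealRing.principal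
      (Ideal.comap (algebraMap (Polynomial K) K[T;T⁻¹]) I)
    refine ⟨algebraMap _ _ p, ?_⟩
    rw [← IsLocalization.map_under (Submonoid.powers (Polynomial.X : Polynomial K)) K[T;T⁻¹] I, Ideal.under, hp]
    simpa [Ideal.submodule_span_eq] using Ideal.map_span (algebraMap (Polynomial K) K[T;T⁻¹]) {p}

end Laurent

/-! ### The abstract algebra of sections along an orbit -/

/-- A differential graded `K[𝔾_m]`-module `M` with fibres `V g`, multiplications `V g₂ × V g₁ → V g`
for `g = g₂ g₁` depending algebraically on `(g₂, g₁)`, associative up to algebraic homotopies. The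
endomorphisms of the orbit of an object under a rational `𝔾_m`-action are an example. -/
structure OrbitAlgebra (K : Type u) [Field K] (M : Type v) [AddCommGroup M] [Module K[T;T⁻¹] M]
    (V : Kˣ → Type w) [∀ g, AddCommGroup (V g)] [∀ g, Module K (V g)] where
  deg : ZMod 2 → Submodule K[T;T⁻¹] M
  d : M →ₗ[K[T;T⁻¹]] M
  fibreDeg : ∀ g, ZMod 2 → Submodule K (V g)
  fibreD : ∀ g, V g →ₗ[K] V g
  ev : ∀ g, M →ₛₗ[evalAt g] V g
  d_mem : ∀ {i a}, a ∈ deg i → d a ∈ deg (i - 1)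
  d_sq : ∀ {i a}, a ∈ deg i → d (d a) = 0
  ev_mem : ∀ g {i a}, a ∈ deg i → ev g a ∈ fibreDeg g i
  ev_surjective : ∀ g {i b}, b ∈ fibreDeg g i → ∃ a ∈ deg i, ev g a = b
  ev_kernel : ∀ g {i a}, a ∈ deg i → ev g a = 0 → ∃ b ∈ deg i, a = (T 1 - C (g : K)) • b
  ev_d : ∀ g a, ev g (d a) = fibreD g (ev g a)
  ev_injective : ∀ {a}, (∀ g, ev g a = 0) → a = 0
  smul_cancel : ∀ {f : K[T;T⁻¹]}, f ≠ 0 → ∀ {a : M}, f • a = 0 → a = 0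
  mul : ∀ {g₂ g₁ g : Kˣ}, g = g₂ * g₁ → V g₂ →ₗ[K] V g₁ →ₗ[K] V g
  /-- The product of two sections, expanded in powers of `g₁` with coefficients depending on
  `g₂ g₁`. -/
  prod : M → M → ℤ →₀ M
  prod_mem : ∀ {i j b a}, b ∈ deg i → a ∈ deg j → ∀ k, prod b a k ∈ deg (i + j)
  ev_prod : ∀ {g₂ g₁ g : Kˣ} (h : g = g₂ * g₁) (b a : M), mul h (ev g₂ b) (ev g₁ a) =
    (prod b a).sum fun k x => ((g₁ ^ k : Kˣ) : K) • ev g x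
  leibniz : ∀ {g₂ g₁ g : Kˣ} (h : g = g₂ * g₁) {i j b a}, b ∈ fibreDeg g₂ i → a ∈ fibreDeg g₁ j →
    fibreD g (mul h b a) + mul h b (fibreD g₁ a) + sign (j - 1) • mul h (fibreD g₂ b) a = 0
  -- The homotopy need not vary algebraically: this relation only serves to compare scalars in the
  -- cohomology of a single fibre.
  assoc : ∀ {g₃ g₂ g₁ g₃₂ g₂₁ g : Kˣ} (h₃₂ : g₃₂ = g₃ * g₂) (h₂₁ : g₂₁ = g₂ * g₁)
    (h : g = g₃₂ * g₁) (h' : g = g₃ * g₂₁) {c b a}, c ∈ fibreDeg g₃ 0 → b ∈ fibreDeg g₂ 0 →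
    a ∈ fibreDeg g₁ 0 → fibreD g₃ c = 0 → fibreD g₂ b = 0 → fibreD g₁ a = 0 →
    ∃ n ∈ fibreDeg g 1, mul h (mul h₃₂ c b) a - mul h' c (mul h₂₁ b a) = fibreD g n
  /-- Associativity for three sections, the last of which is only considered at `1`, with an
  algebraic homotopy. -/
  assoc_one : ∀ {c b a}, c ∈ deg 0 → b ∈ deg 0 → a ∈ deg 0 → d c = 0 → d b = 0 → d a = 0 →
    ∃ n : ℤ →₀ M, (∀ k, n k ∈ deg 1) ∧
      ∀ {g₃ g₂ g : Kˣ} (h : g = g₃ * g₂) (h₁ : g = g * 1) (h₂ : g₂ = g₂ * 1),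
        mul h₁ (mul h (ev g₃ c) (ev g₂ b)) (ev 1 a) -
          mul h (ev g₃ c) (mul h₂ (ev g₂ b) (ev 1 a)) =
        n.sum fun k x => ((g₂ ^ k : Kˣ) : K) • ev g (d x)
  one : V 1
  one_mem : one ∈ fibreDeg 1 0
  one_closed : fibreD 1 one = 0
  mul_one : ∀ (h : (1 : Kˣ) = 1 * 1) {i b}, b ∈ fibreDeg 1 i → fibreD 1 b = 0 →
    ∃ n ∈ fibreDeg 1 (i - 1), mul h b one - b = fibreD 1 n

namespace OrbitAlgebra

variable {K : Type u} [Field K] {M : Type v} [AddCommGroup M] [Module K[T;T⁻¹] M]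
  {V : Kˣ → Type w} [∀ g, AddCommGroup (V g)] [∀ g, Module K (V g)] (A : OrbitAlgebra K M V)

/-! ### Expansions in powers of a coordinate -/

/-- The value `∑ zᵏ n_k(g)` of an expansion `∑ zᵏ n_k`. -/
def evc (z g : Kˣ) : (ℤ →₀ M) →+ V g :=
  Finsupp.liftAddHom fun k => (DistribSMul.toAddMonoidHom (V g) ((z ^ k : Kˣ) : K)).comp
    (A.ev g).toAddMonoidHom

theorem evc_apply (z g : Kˣ) (n : ℤ →₀ M) :
    A.evc z g n = n.sum fun k x => ((z ^ k : Kˣ) : K) • A.ev g x := rfl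

@[simp] theorem evc_single (z g : Kˣ) (k : ℤ) (x : M) :
    A.evc z g (Finsupp.single k x) = ((z ^ k : Kˣ) : K) • A.ev g x := by
  simp [evc]

theorem evc_smul (z g : Kˣ) (f : K[T;T⁻¹]) (n : ℤ →₀ M) :
    A.evc z g (f • n) = evalAt g f • A.evc z g n := by
  induction n using Finsupp.induction_linear with
  | zero => simp
  | add p q hp hq => simp [hp, hq]
  | single k x => rw [Finsupp.smul_single, evc_single, evc_single, map_smulₛₗ, smul_comm]

variable (K M) in
/-- Multiplication of an expansion by the `j`-th power of the coordinate. -/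
def shift (j : ℤ) : (ℤ →₀ M) →ₗ[K[T;T⁻¹]] (ℤ →₀ M) :=
  Finsupp.lmapDomain M K[T;T⁻¹] (· + j)

@[simp] theorem shift_single (j k : ℤ) (x : M) :
    shift K M j (Finsupp.single k x) = Finsupp.single (k + j) x := by
  simp [shift, Finsupp.mapDomain_single]

theorem evc_shift (z g : Kˣ) (j : ℤ) (n : ℤ →₀ M) :
    A.evc z g (shift K M j n) = ((z ^ j : Kˣ) : K) • A.evc z g n := by
  induction n using Finsupp.induction_linear with
  | zero => simp
  | add p q hp hq => simp [hp, hq]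
  | single k x => simp [smul_smul, zpow_add, mul_comm]

/-- Apply the differential to all coefficients of an expansion. -/
def dC : (ℤ →₀ M) →ₗ[K[T;T⁻¹]] (ℤ →₀ M) := Finsupp.mapRange.linearMap A.d

@[simp] theorem dC_apply (n : ℤ →₀ M) (k : ℤ) : A.dC n k = A.d (n k) := by
  simp [dC]

@[simp] theorem dC_single (k : ℤ) (x : M) :
    A.dC (Finsupp.single k x) = Finsupp.single k (A.d x) := by
  simp [dC]

theorem evc_dC (z g : Kˣ) (n : ℤ →₀ M) : A.evc z g (A.dC n) = A.fibreD g (A.evc z g n) := by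
  induction n using Finsupp.induction_linear with
  | zero => simp
  | add p q hp hq => simp [hp, hq]
  | single k x => simp [ev_d]

variable (K M) in
/-- Set the coordinate of an expansion equal to `1`. -/
def total : (ℤ →₀ M) →ₗ[K[T;T⁻¹]] M := Finsupp.lsum K[T;T⁻¹] fun _ => LinearMap.id

variable (K M) in
/-- The derivative of an expansion with respect to its coordinate, at `1`. -/
def deriv : (ℤ →₀ M) →ₗ[K[T;T⁻¹]] M := Finsupp.lsum K[T;T⁻¹] fun k => k • LinearMap.id

@[simp] theorem total_single (k : ℤ) (x : M) : total K M (Finsupp.single k x) = x := by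
  simp [total]

@[simp] theorem deriv_single (k : ℤ) (x : M) : deriv K M (Finsupp.single k x) = k • x := by
  simp [deriv]

theorem total_shift (j : ℤ) (n : ℤ →₀ M) : total K M (shift K M j n) = total K M n := by
  induction n using Finsupp.induction_linear with
  | zero => simp
  | add p q hp hq => simp [hp, hq]
  | single k x => simp

theorem deriv_shift (j : ℤ) (n : ℤ →₀ M) :
    deriv K M (shift K M j n) = deriv K M n + j • total K M n := by
  induction n using Finsupp.induction_linear with
  | zero => simp
  | add p q hp hq => simp only [map_add, hp, hq, smul_add]; abel
  | single k x => simp [add_smul]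

theorem total_dC (n : ℤ →₀ M) : total K M (A.dC n) = A.d (total K M n) := by
  induction n using Finsupp.induction_linear with
  | zero => simp
  | add p q hp hq => simp [hp, hq]
  | single k x => simp

theorem deriv_dC (n : ℤ →₀ M) : deriv K M (A.dC n) = A.d (deriv K M n) := by
  induction n using Finsupp.induction_linear with
  | zero => simp
  | add p q hp hq => simp [hp, hq]
  | single k x => simp

theorem ev_total (g : Kˣ) (n : ℤ →₀ M) : A.ev g (total K M n) = A.evc 1 g n := by
  induction n using Finsupp.induction_linear with
  | zero => simp
  | add p q hp hq => simp [hp, hq]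
  | single k x => simp

theorem total_mem {N : Submodule K[T;T⁻¹] M} {n : ℤ →₀ M} (h : ∀ k, n k ∈ N) :
    total K M n ∈ N := by
  rw [total, Finsupp.lsum_apply]
  exact Submodule.sum_mem _ fun k _ => h k

theorem deriv_mem {N : Submodule K[T;T⁻¹] M} {n : ℤ →₀ M} (h : ∀ k, n k ∈ N) :
    deriv K M n ∈ N := by
  rw [deriv, Finsupp.lsum_apply]
  exact Submodule.sum_mem _ fun k _ => zsmul_mem (h k) k

/-- Linear functionals reduce this to a scalar Laurent polynomial, which vanishes if all its values
on the infinite set `Kˣ` do. -/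
theorem eq_zero_of_sum_zpow_smul [Infinite K] {W : Type*} [AddCommGroup W] [Module K W]
    (n : ℤ →₀ W) (h : ∀ z : Kˣ, (n.sum fun k x => ((z ^ k : Kˣ) : K) • x) = 0) : n = 0 := by
  ext k
  rw [Finsupp.zero_apply, ← Module.forall_dual_apply_eq_zero_iff K]
  intro φ
  let f : K[T;T⁻¹] := n.sum fun k x => C (φ x) * T k
  have hf : f = 0 := by
    apply RationalAction.laurent_eq_zero
    intro z
    have := congrArg φ (h z)
    simp only [Finsupp.sum, map_sum, map_smul, map_zero, smul_eq_mul] at this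
    simp only [f, Finsupp.sum, map_sum, map_mul, evalAt_C, evalAt_T]
    exact (Finset.sum_congr rfl fun k _ => mul_comm _ _).trans this
  have hk : f.coeff k = φ (n k) := coeff_sum_C_mul_T (fun _ => φ) (fun _ => map_zero φ) n k
  rw [← hk, hf]
  simp

/-- This is how identities between expansions are checked pointwise: for fixed `g` the powers of `z`
are independent, and a section is determined by its values. -/
theorem evc_injective [Infinite K] {n n' : ℤ →₀ M} (h : ∀ z g, A.evc z g n = A.evc z g n') :
    n = n' := by
  rw [← sub_eq_zero]
  set m := n - n'
  have hm : ∀ z g, A.evc z g m = 0 := fun z g => by simp [m, h]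
  ext k
  apply A.ev_injective
  intro g
  have := eq_zero_of_sum_zpow_smul (m.mapRange (A.ev g) (map_zero _)) fun z => by
    rw [← hm z g, evc_apply, Finsupp.sum_mapRange_index (by simp)]
  simpa using DFunLike.congr_fun this k

/-! ### Products of sections -/

theorem mul_ev_ev {g₂ g₁ g : Kˣ} (h : g = g₂ * g₁) (b a : M) :
    A.mul h (A.ev g₂ b) (A.ev g₁ a) = A.evc g₁ g (A.prod b a) :=
  A.ev_prod h b a

theorem evc_prod (z g : Kˣ) (b a : M) :
    A.evc z g (A.prod b a) =
      A.mul (inv_mul_cancel_right g z).symm (A.ev (g * z⁻¹) b) (A.ev z a) :=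
  (A.mul_ev_ev _ b a).symm

section Infinite

variable [Infinite K]

theorem prod_add_left (b b' a : M) : A.prod (b + b') a = A.prod b a + A.prod b' a :=
  A.evc_injective fun z g => by simp [evc_prod]

theorem prod_add_right (b a a' : M) : A.prod b (a + a') = A.prod b a + A.prod b a' :=
  A.evc_injective fun z g => by simp [evc_prod]

theorem prod_sub_left (b b' a : M) : A.prod (b - b') a = A.prod b a - A.prod b' a :=
  A.evc_injective fun z g => by simp [evc_prod]

theorem prod_sub_right (b a a' : M) : A.prod b (a - a') = A.prod b a - A.prod b a' :=
  A.evc_injective fun z g => by simp [evc_prod]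

@[simp] theorem prod_zero_left (a : M) : A.prod 0 a = 0 :=
  A.evc_injective fun z g => by simp [evc_prod]

@[simp] theorem prod_zero_right (b : M) : A.prod b 0 = 0 :=
  A.evc_injective fun z g => by simp [evc_prod]

/-- The left factor is evaluated at `g₂ = g z⁻¹`, where `T j` takes the value `g ^ j z ^ (-j)`; the
second factor is the shift. -/
theorem prod_T_smul_left (j : ℤ) (b a : M) :
    A.prod ((T j : K[T;T⁻¹]) • b) a = (T j : K[T;T⁻¹]) • shift K M (-j) (A.prod b a) :=
  A.evc_injective fun z g => by
    rw [evc_smul, evc_shift, evc_prod, evc_prod]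
    simp [smul_smul, mul_zpow]

theorem prod_T_smul_right (j : ℤ) (b a : M) :
    A.prod b ((T j : K[T;T⁻¹]) • a) = shift K M j (A.prod b a) :=
  A.evc_injective fun z g => by
    rw [evc_shift, evc_prod, evc_prod]
    simp

theorem prod_T_sub_one_smul_right (b a : M) :
    A.prod b ((T 1 - 1 : K[T;T⁻¹]) • a) = shift K M 1 (A.prod b a) - A.prod b a := by
  rw [sub_smul, one_smul, prod_sub_right, prod_T_smul_right]

theorem prod_leibniz {i j : ZMod 2} {b a : M} (hb : b ∈ A.deg i) (ha : a ∈ A.deg j) :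
    A.dC (A.prod b a) + A.prod b (A.d a) + sign (j - 1) • A.prod (A.d b) a = 0 :=
  A.evc_injective fun z g => by
    simp only [map_add, map_zsmul, evc_dC, evc_prod, ev_d, map_zero]
    exact A.leibniz _ (A.ev_mem _ hb) (A.ev_mem _ ha)

end Infinite

theorem sign_neg_one : sign (0 - 1) = -1 := by decide

/-- Right multiplication by the value of `a` at `1`. -/
def mulRight (a m : M) : M := total K M (A.prod m a)

theorem ev_mulRight (a m : M) {g : Kˣ} (h : g = g * 1) :
    A.ev g (A.mulRight a m) = A.mul h (A.ev g m) (A.ev 1 a) := by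
  rw [mulRight, ev_total, mul_ev_ev]

/-- The derivative at `1` of right multiplication by the values of `a`. -/
def derivRight (a m : M) : M := deriv K M (A.prod m a)

end OrbitAlgebra

/-! ### Extending the unit to a cocycle -/

namespace OrbitAlgebra

variable {K : Type u} [Field K] {M : Type v} [AddCommGroup M] [Module K[T;T⁻¹] M]
  {V : Kˣ → Type w} [∀ g, AddCommGroup (V g)] [∀ g, Module K (V g)] (A : OrbitAlgebra K M V)

/-- The coboundaries of degree `i`. -/
abbrev boundaries (i : ZMod 2) : Submodule K[T;T⁻¹] M := (A.deg (i - 1)).map A.d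

theorem d_mem_boundaries {i : ZMod 2} {a : M} (ha : a ∈ A.deg (i - 1)) :
    A.d a ∈ A.boundaries i :=
  Submodule.mem_map_of_mem ha

theorem boundaries_le_cocycles (i : ZMod 2) : A.boundaries i ≤ Cocycles A.deg A.d i := by
  rintro _ ⟨a, ha, rfl⟩
  have h : i - 1 - 1 = i := by rw [sub_sub, show (1 + 1 : ZMod 2) = 0 from rfl, sub_zero]
  exact ⟨h ▸ A.d_mem ha, A.d_sq ha⟩

/-- A cocycle whose value at `g` is exact is divisible by `T - g` up to coboundaries. -/
theorem exists_eq_add_smul {g : Kˣ} {i : ZMod 2} {m : M} (hm : m ∈ Cocycles A.deg A.d i)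
    (h : ∃ n ∈ A.fibreDeg g (i - 1), A.ev g m = A.fibreD g n) :
    ∃ b ∈ A.boundaries i, ∃ m' ∈ Cocycles A.deg A.d i, m = b + (T 1 - C (g : K)) • m' := by
  obtain ⟨n, hn, hmn⟩ := h
  obtain ⟨θ, hθ, rfl⟩ := A.ev_surjective g hn
  have hb := A.d_mem_boundaries hθ
  have hc := Submodule.sub_mem _ hm (A.boundaries_le_cocycles i hb)
  obtain ⟨m', hm', he⟩ := A.ev_kernel g hc.1 (by rw [map_sub, hmn, ev_d, sub_self])
  refine ⟨_, hb, m', ⟨hm', ?_⟩, by rw [← he]; abel⟩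
  have h0 : A.d (m - A.d θ) = 0 := hc.2
  rw [he, map_smul] at h0
  refine A.smul_cancel (fun h1 => ?_) h0
  have h2 := congrArg (fun f : K[T;T⁻¹] => f.coeff 1) h1
  simp at h2

variable [Infinite K]

omit [Infinite K] in
theorem mulRight_smul (a : M) (f : K[T;T⁻¹]) (m : M) :
    A.mulRight a (f • m) = f • A.mulRight a m := by
  rw [← sub_eq_zero]
  refine A.ev_injective fun g => ?_
  have h : g = g * 1 := (_root_.mul_one g).symm
  simp [A.ev_mulRight _ _ h]

omit [Infinite K] in
theorem mulRight_mem {i : ZMod 2} {a m : M} (ha : a ∈ A.deg 0) (hm : m ∈ A.deg i) :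
    A.mulRight a m ∈ A.deg i :=
  total_mem fun k => add_zero i ▸ A.prod_mem hm ha k

omit [Infinite K] in
theorem derivRight_mem {i : ZMod 2} {a m : M} (ha : a ∈ A.deg 0) (hm : m ∈ A.deg i) :
    A.derivRight a m ∈ A.deg i :=
  deriv_mem fun k => add_zero i ▸ A.prod_mem hm ha k

theorem total_prod_smul (m x : M) :
    total K M (A.prod m ((T 1 - 1 : K[T;T⁻¹]) • x)) = 0 := by
  rw [prod_T_sub_one_smul_right, map_sub, total_shift, sub_self]

theorem deriv_prod_smul (m x : M) :
    deriv K M (A.prod m ((T 1 - 1 : K[T;T⁻¹]) • x)) = total K M (A.prod m x) := by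
  rw [prod_T_sub_one_smul_right, map_sub, deriv_shift, one_smul, add_sub_cancel_left]

/-- The left factor sees `T` at `g z⁻¹`, and differentiating `z⁻¹` at `z = 1` produces the extra
term. Thus `derivRight` is a first order differential operator in `T`, while `mulRight` is linear.
-/
theorem derivRight_smul (a m : M) :
    A.derivRight a ((T 1 - 1 : K[T;T⁻¹]) • m) =
      (T 1 - 1 : K[T;T⁻¹]) • A.derivRight a m - (T 1 : K[T;T⁻¹]) • A.mulRight a m := by
  rw [sub_smul, one_smul, derivRight, prod_sub_left, prod_T_smul_left, map_sub, map_smul,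
    deriv_shift, sub_smul, one_smul, neg_one_smul, smul_add, smul_neg, derivRight, mulRight]
  abel

theorem derivRight_pow_smul (a m : M) (n : ℕ) :
    A.derivRight a ((T 1 - 1 : K[T;T⁻¹]) ^ (n + 1) • m) =
      (T 1 - 1 : K[T;T⁻¹]) ^ (n + 1) • A.derivRight a m -
        ((n + 1 : K[T;T⁻¹]) * T 1 * (T 1 - 1) ^ n) • A.mulRight a m := by
  induction n with
  | zero => simp [derivRight_smul]
  | succ n ih =>
    rw [pow_succ', mul_smul, derivRight_smul, ih, mulRight_smul]
    push_cast
    module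

section FirstOrder

variable {a w : M} (ha : a ∈ A.deg 0) (hda : A.d a = (T 1 - 1 : K[T;T⁻¹]) ^ 2 • w)

include ha hda

/-- Set `z = 1` in the Leibniz rule; the term with `d a` disappears because `d a` is divisible by `T
- 1`. -/
theorem mulRight_d_of_firstOrder {i : ZMod 2} {m : M} (hm : m ∈ A.deg i) :
    A.mulRight a (A.d m) = A.d (A.mulRight a m) := by
  have h := congrArg (total K M) (A.prod_leibniz hm ha)
  rw [hda, pow_two, mul_smul, sign_neg_one, neg_one_smul, map_add, map_add, map_neg, total_dC,
    total_prod_smul, add_zero, map_zero, ← sub_eq_add_neg, sub_eq_zero] at h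
  exact h.symm

/-- Differentiating the Leibniz rule at `z = 1` uses up one factor `T - 1` of `d a`, and a second
one is needed to kill what remains. This is where first order equivariance enters. -/
theorem derivRight_d_of_firstOrder {i : ZMod 2} {m : M} (hm : m ∈ A.deg i) :
    A.derivRight a (A.d m) = A.d (A.derivRight a m) := by
  have h := congrArg (deriv K M) (A.prod_leibniz hm ha)
  rw [hda, pow_two, mul_smul, sign_neg_one, neg_one_smul, map_add, map_add, map_neg, deriv_dC,
    deriv_prod_smul, total_prod_smul, add_zero, map_zero, ← sub_eq_add_neg, sub_eq_zero] at h
  exact h.symm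

theorem mulRight_mem_boundaries_of_firstOrder {i : ZMod 2} {m : M} (hm : m ∈ A.boundaries i) :
    A.mulRight a m ∈ A.boundaries i := by
  obtain ⟨η, hη, rfl⟩ := hm
  rw [A.mulRight_d_of_firstOrder ha hda hη]
  exact A.d_mem_boundaries (A.mulRight_mem ha hη)

theorem derivRight_mem_boundaries_of_firstOrder {i : ZMod 2} {m : M} (hm : m ∈ A.boundaries i) :
    A.derivRight a m ∈ A.boundaries i := by
  obtain ⟨η, hη, rfl⟩ := hm
  rw [A.derivRight_d_of_firstOrder ha hda hη]
  exact A.d_mem_boundaries (A.derivRight_mem ha hη)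

theorem mulRight_mem_cocycles_of_firstOrder {i : ZMod 2} {m : M}
    (hm : m ∈ Cocycles A.deg A.d i) : A.mulRight a m ∈ Cocycles A.deg A.d i := by
  refine ⟨A.mulRight_mem ha hm.1, LinearMap.mem_ker.mpr ?_⟩
  have h0 : A.d m = 0 := hm.2
  rw [← A.mulRight_d_of_firstOrder ha hda hm.1, h0]
  simp [mulRight]

theorem derivRight_mem_cocycles_of_firstOrder {i : ZMod 2} {m : M}
    (hm : m ∈ Cocycles A.deg A.d i) : A.derivRight a m ∈ Cocycles A.deg A.d i := by
  refine ⟨A.derivRight_mem ha hm.1, LinearMap.mem_ker.mpr ?_⟩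
  have h0 : A.d m = 0 := hm.2
  rw [← A.derivRight_d_of_firstOrder ha hda hm.1, h0]
  simp [derivRight]

/-- Right multiplication by a section with value `1` at `1` is the identity on cohomology,
modulo `T - 1`. -/
theorem mulRight_sub_self_of_firstOrder (h1 : A.ev 1 a = A.one) {i : ZMod 2} {m : M}
    (hm : m ∈ Cocycles A.deg A.d i) :
    ∃ b ∈ A.boundaries i, ∃ m' ∈ Cocycles A.deg A.d i,
      A.mulRight a m - m = b + (T 1 - 1 : K[T;T⁻¹]) • m' := by
  have h := A.exists_eq_add_smul (g := 1)
    (Submodule.sub_mem _ (A.mulRight_mem_cocycles_of_firstOrder ha hda hm) hm) (by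
      have h : (1 : Kˣ) = 1 * 1 := (one_mul 1).symm
      rw [map_sub, A.ev_mulRight a m h, h1]
      refine A.mul_one h (A.ev_mem 1 hm.1) ?_
      rw [← ev_d, show A.d m = 0 from hm.2, map_zero])
  simpa using h

/-- Descent step for torsion: if `τ ^ (k + 1)` kills all `τ`-power torsion classes, so does `τ ^ k`.
Applying `derivRight` to `τ ^ (k + 1) m` brings out `(k + 1) T τ ^ k` times `mulRight a m`, and
`mulRight a` is the identity modulo `τ`. -/
theorem mem_boundaries_of_pow_succ [CharZero K] (h1 : A.ev 1 a = A.one) {i : ZMod 2} {k : ℕ}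
    (hk : ∀ m ∈ Cocycles A.deg A.d i, ∀ j, (T 1 - 1 : K[T;T⁻¹]) ^ j • m ∈ A.boundaries i →
      (T 1 - 1 : K[T;T⁻¹]) ^ (k + 1) • m ∈ A.boundaries i)
    {m : M} (hm : m ∈ Cocycles A.deg A.d i) {j : ℕ}
    (hj : (T 1 - 1 : K[T;T⁻¹]) ^ j • m ∈ A.boundaries i) :
    (T 1 - 1 : K[T;T⁻¹]) ^ k • m ∈ A.boundaries i := by
  set τ : K[T;T⁻¹] := T 1 - 1
  have hm1 := hk m hm j hj
  have hψ : τ ^ (k + 1) • A.mulRight a m ∈ A.boundaries i := by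
    rw [← mulRight_smul]
    exact A.mulRight_mem_boundaries_of_firstOrder ha hda hm1
  have hD := A.derivRight_mem_boundaries_of_firstOrder ha hda hm1
  rw [derivRight_pow_smul] at hD
  -- After one more factor `τ` the term with `mulRight a m` becomes exact, so the class of
  -- `derivRight a m` is itself torsion and `hk` applies to it.
  have hD2 : τ ^ (k + 2) • A.derivRight a m ∈ A.boundaries i := by
    have e : τ ^ (k + 2) • A.derivRight a m = τ • (τ ^ (k + 1) • A.derivRight a m -
        ((k + 1 : K[T;T⁻¹]) * T 1 * τ ^ k) • A.mulRight a m) +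
        ((k + 1 : K[T;T⁻¹]) * T 1) • τ ^ (k + 1) • A.mulRight a m := by module
    rw [e]
    exact add_mem (Submodule.smul_mem _ _ hD) (Submodule.smul_mem _ _ hψ)
  have hD3 := hk _ (A.derivRight_mem_cocycles_of_firstOrder ha hda hm) _ hD2
  have hψ2 : τ ^ k • A.mulRight a m ∈ A.boundaries i := by
    -- Characteristic zero makes `k + 1` invertible.
    have hu : IsUnit ((k + 1 : K[T;T⁻¹]) * T 1) := by
      refine IsUnit.mul ?_ (LaurentPolynomial.isUnit_T 1)
      have : (C ((k : K) + 1) : K[T;T⁻¹]) = k + 1 := by simp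
      rw [← this]
      exact (IsUnit.mk0 _ (Nat.cast_add_one_ne_zero k)).map _
    have h2 := sub_mem hD3 hD
    rw [sub_sub_cancel, mul_smul] at h2
    exact (Submodule.smul_mem_iff_of_isUnit _ hu).mp h2
  obtain ⟨b, hb, m', hm', e⟩ := A.mulRight_sub_self_of_firstOrder ha hda h1 hm
  have hsub : τ ^ (k + 1) • (A.mulRight a m - m) ∈ A.boundaries i := by
    rw [smul_sub]
    exact sub_mem hψ hm1
  -- The error term of `mulRight a m` against `m` is torsion as well, so the same bound holds for
  -- it.
  have hm2 : τ ^ (k + 1) • m' ∈ A.boundaries i := by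
    refine hk m' hm' (k + 2) ?_
    have e2 : τ ^ (k + 2) • m' = τ ^ (k + 1) • (A.mulRight a m - m) - τ ^ (k + 1) • b := by
      rw [e]; module
    rw [e2]
    exact sub_mem hsub (Submodule.smul_mem _ _ hb)
  have e3 : τ ^ k • m = τ ^ k • A.mulRight a m - τ ^ k • b - τ ^ (k + 1) • m' := by
    have e4 : m = A.mulRight a m - (b + τ • m') := by rw [← e]; abel
    conv_lhs => rw [e4]
    module
  rw [e3]
  exact sub_mem (sub_mem hψ2 (Submodule.smul_mem _ _ hb)) hm2

omit ha hda [Infinite K] in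
-- Over a Noetherian ring the kernels of the powers of `T - 1` on finitely generated cohomology
-- stabilise.
theorem exists_pow_smul_mem_boundaries {i : ZMod 2}
    [Module.Finite K[T;T⁻¹] (Cohomology A.deg A.d i)] :
    ∃ k : ℕ, ∀ m ∈ Cocycles A.deg A.d i, ∀ j, (T 1 - 1 : K[T;T⁻¹]) ^ j • m ∈ A.boundaries i →
      (T 1 - 1 : K[T;T⁻¹]) ^ k • m ∈ A.boundaries i := by
  let H := Cohomology A.deg A.d i
  let τ : K[T;T⁻¹] := T 1 - 1
  let f : H →ₗ[K[T;T⁻¹]] H := LinearMap.lsmul K[T;T⁻¹] H τ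
  have hf : ∀ n (x : H), (f ^ n) x = τ ^ n • x := by
    intro n x
    induction n with
    | zero => simp
    | succ n ih => rw [pow_succ', Module.End.mul_apply, ih, pow_succ', mul_smul]; rfl
  have hmk : ∀ n (m : M) (hm : m ∈ Cocycles A.deg A.d i),
      (f ^ n) (Submodule.Quotient.mk ⟨m, hm⟩) = 0 ↔ τ ^ n • m ∈ A.boundaries i := by
    intro n m hm
    rw [hf, ← Submodule.Quotient.mk_smul, Submodule.Quotient.mk_eq_zero]
    rfl
  obtain ⟨k, hk⟩ := monotone_stabilizes_iff_noetherian.mpr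
    (inferInstance : IsNoetherian K[T;T⁻¹] H) (LinearMap.iterateKer f)
  refine ⟨k, fun m hm j hj => ?_⟩
  rw [← hmk _ _ hm] at hj ⊢
  rcases le_total j k with h | h
  · exact (LinearMap.iterateKer f).monotone h hj
  · have := hk j h
    have h2 : Submodule.Quotient.mk ⟨m, hm⟩ ∈ LinearMap.iterateKer f j := hj
    rw [← this] at h2
    exact h2

/-- The uniform exponent exists by finiteness and descends to `0`: the cohomology has no `(T -
1)`-power torsion. -/
theorem mem_boundaries_of_pow_smul_mem [CharZero K] (h1 : A.ev 1 a = A.one) {i : ZMod 2}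
    [Module.Finite K[T;T⁻¹] (Cohomology A.deg A.d i)] {m : M} (hm : m ∈ Cocycles A.deg A.d i)
    {j : ℕ} (hj : (T 1 - 1 : K[T;T⁻¹]) ^ j • m ∈ A.boundaries i) : m ∈ A.boundaries i := by
  obtain ⟨k, hk⟩ := A.exists_pow_smul_mem_boundaries (i := i)
  induction k with
  | zero => simpa using hk m hm j hj
  | succ k ih => exact ih fun m hm j hj => A.mem_boundaries_of_pow_succ ha hda h1 hk hm hj

/-- If the unit extends to first order, then it extends to a cocycle. -/
theorem exists_cocycle_of_firstOrder [CharZero K] (h1 : A.ev 1 a = A.one) (hw : w ∈ A.deg 1)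
    [Module.Finite K[T;T⁻¹] (Cohomology A.deg A.d 1)] :
    ∃ σ ∈ Cocycles A.deg A.d 0, A.ev 1 σ = A.one := by
  have hτ : (T 1 - 1 : K[T;T⁻¹]) ≠ 0 := RationalAction.T_sub_one_ne_zero
  have hwc : w ∈ Cocycles A.deg A.d 1 := by
    refine ⟨hw, A.smul_cancel (pow_ne_zero 2 hτ) ?_⟩
    rw [← map_smul, ← hda, A.d_sq ha]
  -- The class of `w` is torsion, since `(T - 1)² w = d a`.
  have hb : w ∈ A.boundaries 1 := by
    refine A.mem_boundaries_of_pow_smul_mem ha hda h1 hwc (j := 2) ?_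
    rw [← hda]
    exact A.d_mem_boundaries (by simpa using ha)
  obtain ⟨η, hη, rfl⟩ := hb
  rw [sub_self] at hη
  refine ⟨a - (T 1 - 1 : K[T;T⁻¹]) ^ 2 • η,
    ⟨sub_mem ha (Submodule.smul_mem _ _ hη), LinearMap.mem_ker.mpr ?_⟩, ?_⟩
  · rw [map_sub, map_smul, hda, sub_self]
  · rw [map_sub, map_smulₛₗ, h1]
    simp

end FirstOrder

/-- If the first order deformation class of the unit vanishes, then the unit extends to a
cocycle. -/
theorem exists_cocycle [CharZero K] [Module.Finite K[T;T⁻¹] (Cohomology A.deg A.d 1)] {a z : M}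
    (ha : a ∈ A.deg 0) (h1 : A.ev 1 a = A.one) (hz : z ∈ A.deg 1)
    (haz : A.d a = (T 1 - 1 : K[T;T⁻¹]) • z)
    (hex : ∃ n ∈ A.fibreDeg 1 (1 - 1), A.ev 1 z = A.fibreD 1 n) :
    ∃ σ ∈ Cocycles A.deg A.d 0, A.ev 1 σ = A.one := by
  have hzc : z ∈ Cocycles A.deg A.d 1 := by
    refine ⟨hz, A.smul_cancel RationalAction.T_sub_one_ne_zero ?_⟩
    rw [← map_smul, ← haz, A.d_sq ha]
  obtain ⟨_, ⟨θ, hθ, rfl⟩, w, hw, e⟩ := A.exists_eq_add_smul hzc hex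
  rw [sub_self] at hθ
  -- Subtracting `(T - 1) θ` keeps the value at `1` and removes the exact part `d θ` of `z`, so that
  -- the differential becomes `(T - 1)² w`.
  refine A.exists_cocycle_of_firstOrder (a := a - (T 1 - 1 : K[T;T⁻¹]) • θ) (w := w)
    (sub_mem ha (Submodule.smul_mem _ _ hθ)) ?_ ?_ hw.1
  · rw [map_sub, map_smul, haz, e]
    simp [pow_two, mul_smul]
  · rw [map_sub, map_smulₛₗ, h1]
    simp

end OrbitAlgebra

/-! ## Normalised cocycles with values in Laurent polynomials -/

section Cocycle

variable {K : Type u} [Field K]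

/-- The function `(x, z) ↦ ∑ c_k(x) zᵏ`. -/
def laurentFun (P : ℤ →₀ (Kˣ → K)) (x z : Kˣ) : K := P.sum fun k c => c x * ((z ^ k : Kˣ) : K)

theorem laurentFun_add (P Q : ℤ →₀ (Kˣ → K)) (x z : Kˣ) :
    laurentFun (P + Q) x z = laurentFun P x z + laurentFun Q x z :=
  Finsupp.sum_add_index' (by simp) (by simp [add_mul])

theorem laurentFun_single (k : ℤ) (c : Kˣ → K) (x z : Kˣ) :
    laurentFun (Finsupp.single k c) x z = c x * ((z ^ k : Kˣ) : K) :=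
  Finsupp.sum_single_index (by simp)

variable [Infinite K] {P : ℤ →₀ (Kˣ → K)}

/-- Compare coefficients of `z ^ (2N)` in the cocycle identity, for `N` an extreme exponent. On the
right only `N + N` contributes, giving `c_N(x)² x ^ N`, nonzero for some `x`; so the coefficient
`c_{2N}(x²)` on the left is nonzero. -/
theorem add_self_mem_support_of_cocycle
    (h : ∀ x z, laurentFun P x x * laurentFun P (x * x) z =
      laurentFun P x (x * z) * laurentFun P x z) {N : ℤ} (hN : N ∈ P.support)
    (hmax : ∀ a ∈ P.support, ∀ b ∈ P.support, a + b = N + N → a = N ∧ b = N) :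
    N + N ∈ P.support := by
  obtain ⟨x, hx⟩ := Function.ne_iff.mp (Finsupp.mem_support_iff.mp hN)
  -- The weights `s k` allow a single definition for both kinds of factor: `s = 1` gives `q(y, z)`
  -- and `s k = x ^ k` gives `q(y, x z)`.
  let f : (ℤ → Kˣ) → Kˣ → K[T;T⁻¹] := fun s y => P.sum fun k c => C (c y * s k) * T k
  have hev : ∀ s y z, evalAt z (f s y) =
      P.sum fun k c => c y * ((s k : Kˣ) : K) * ((z ^ k : Kˣ) : K) := fun s y z => by
    simp only [f, Finsupp.sum, map_sum, map_mul, evalAt_C, evalAt_T]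
  have hco : ∀ s y k, (f s y).coeff k = P k y * s k := fun s y k =>
    coeff_sum_C_mul_T (fun k (c : Kˣ → K) => c y * s k) (by simp) P k
  have hsupp : ∀ s y, (f s y).coeff.support ⊆ P.support := fun s y k hk => by
    rw [Finsupp.mem_support_iff, hco] at hk
    rw [Finsupp.mem_support_iff]
    intro h0
    simp [h0] at hk
  have hpoly : C (laurentFun P x x) * f 1 (x * x) = f (fun k => x ^ k) x * f 1 x := by
    rw [← sub_eq_zero]
    apply RationalAction.laurent_eq_zero
    intro z
    rw [map_sub, map_mul, map_mul, hev, hev, hev, evalAt_C, sub_eq_zero]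
    simpa [laurentFun, mul_zpow, mul_assoc] using h x z
  have hc := congrArg (fun p : K[T;T⁻¹] => p.coeff (N + N)) hpoly
  rw [AddMonoidAlgebra.coeff_mul_add_of_uniqueAdd
    (fun a b ha hb hab => hmax a (hsupp _ _ ha) b (hsupp _ _ hb) hab), hco, hco,
    ← LaurentPolynomial.smul_eq_C_mul, AddMonoidAlgebra.coeff_smul, Finsupp.smul_apply, hco] at hc
  rw [Finsupp.mem_support_iff]
  intro h0
  rw [h0] at hc
  simp at hc
  exact hx (hc.elim (fun h => h.resolve_right (zpow_ne_zero N x.ne_zero)) id)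

/-- The largest and the smallest exponent stay in the support when doubled, so both are zero, and
the function does not depend on `z`. -/
theorem laurentFun_eq_one_of_cocycle (h1 : ∀ x, laurentFun P x 1 = 1)
    (h : ∀ x z, laurentFun P x x * laurentFun P (x * x) z =
      laurentFun P x (x * z) * laurentFun P x z) (x z : Kˣ) : laurentFun P x z = 1 := by
  have hs : P.support ⊆ {0} := by
    intro k hk
    have hne : P.support.Nonempty := ⟨k, hk⟩
    have hmax := P.support.le_max' _ (add_self_mem_support_of_cocycle h
      (P.support.max'_mem hne) fun a ha b hb hab => by
        have := P.support.le_max' a ha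
        have := P.support.le_max' b hb
        omega)
    have hmin := P.support.min'_le _ (add_self_mem_support_of_cocycle h
      (P.support.min'_mem hne) fun a ha b hb hab => by
        have := P.support.min'_le a ha
        have := P.support.min'_le b hb
        omega)
    have := P.support.le_max' k hk
    have := P.support.min'_le k hk
    rw [Finset.mem_singleton]
    omega
  rw [← h1 x, laurentFun, laurentFun, Finsupp.sum_of_support_subset _ hs _ (by simp),
    Finsupp.sum_of_support_subset _ hs _ (by simp)]
  simp

omit [Infinite K] in
/-- A polynomial in `z`, with coefficients depending polynomially on `x z`, is a polynomial in
`z` with coefficients depending on `x`. -/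
theorem exists_laurentFun (f : ℤ →₀ K[T;T⁻¹]) : ∃ P : ℤ →₀ (Kˣ → K), ∀ x z : Kˣ,
    laurentFun P x z = f.sum fun k p => ((z ^ k : Kˣ) : K) * evalAt (x * z) p := by
  induction f using Finsupp.induction_linear with
  | zero => exact ⟨0, by simp [laurentFun]⟩
  | add f f' hf hf' =>
    obtain ⟨P, hP⟩ := hf
    obtain ⟨P', hP'⟩ := hf'
    refine ⟨P + P', fun x z => ?_⟩
    rw [laurentFun_add, hP, hP', Finsupp.sum_add_index' (by simp) (by simp [mul_add])]
  | single k p =>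
    induction p using LaurentPolynomial.induction_on' with
    | add p p' hp hp' =>
      obtain ⟨P, hP⟩ := hp
      obtain ⟨P', hP'⟩ := hp'
      refine ⟨P + P', fun x z => ?_⟩
      rw [laurentFun_add, hP, hP', ← Finsupp.sum_add_index' (by simp) (by simp [mul_add]),
        Finsupp.single_add]
    | C_mul_T n a =>
      refine ⟨Finsupp.single (k + n) fun x => a * ((x ^ n : Kˣ) : K), fun x z => ?_⟩
      rw [laurentFun_single, Finsupp.sum_single_index (by simp)]
      simp only [map_mul, evalAt_C, evalAt_T, zpow_add, mul_zpow, Units.val_mul]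
      ring

/-- A Laurent polynomial 2-cocycle on `𝔾_m`, normalised in its second argument, is trivial. -/
theorem eq_single_of_cocycle (f : ℤ →₀ K[T;T⁻¹]) (q : Kˣ → Kˣ → K)
    (hq : ∀ x z, q x z = f.sum fun k p => ((z ^ k : Kˣ) : K) * evalAt (x * z) p)
    (h1 : ∀ x, q x 1 = 1) (h : ∀ x z, q x x * q (x * x) z = q x (x * z) * q x z) :
    f = Finsupp.single 0 1 := by
  obtain ⟨P, hP⟩ := exists_laurentFun f
  have hPq : ∀ x z, laurentFun P x z = q x z := fun x z => by rw [hP, hq]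
  have hone : ∀ x z, q x z = 1 := fun x z => by
    rw [← hPq]
    exact laurentFun_eq_one_of_cocycle (fun x => by rw [hPq, h1])
      (fun x z => by simp only [hPq, h]) x z
  rw [← sub_eq_zero]
  ext1 k
  apply RationalAction.laurent_eq_zero
  intro g
  -- At the point `(g z⁻¹, z)` the identity `q = 1` reads as an expansion in `z` with coefficients
  -- `f k` at `g`, so uniqueness of expansions applies.
  have := OrbitAlgebra.eq_zero_of_sum_zpow_smul (K := K)
    ((f - Finsupp.single 0 1).mapRange (evalAt g) (map_zero _)) fun z => by
    have hz : (f.sum fun k p => ((z ^ k : Kˣ) : K) * evalAt g p) = 1 := by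
      rw [← hone (g * z⁻¹) z, hq]
      simp
    rw [Finsupp.sum_mapRange_index (by simp), Finsupp.sum_sub_index (by simp [mul_sub])]
    simp only [smul_eq_mul]
    rw [hz, Finsupp.sum_single_index (by simp)]
    simp
  exact DFunLike.congr_fun this k

end Cocycle

/-! ## Endomorphisms killing torsion -/

section Module

variable {K : Type u} [Field K] {H : Type v} [AddCommGroup H] [Module K[T;T⁻¹] H]
  [Module.Finite K[T;T⁻¹] H]

theorem T_sub_one_mul_eq_C {r : K[T;T⁻¹]} {c : K} (h : (T 1 - 1) * r = C c) : c = 0 := by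
  have := congrArg (evalAt 1) h
  simpa using this.symm

/-- An idempotent endomorphism of a finitely generated `K[𝔾_m]`-module with one-dimensional fibre
at `1`, which kills torsion and is the identity on this fibre, has image free of rank one. -/
theorem exists_generator_of_idempotent (ψ : H →ₗ[K[T;T⁻¹]] H) (s : H)
    (htors : ∀ (f : K[T;T⁻¹]) (x : H), f ≠ 0 → f • x = 0 → ψ x = 0)
    (hidem : ∀ x, ψ (ψ x) = ψ x) (hfib : ∀ x, ∃ y, ψ x - x = (T 1 - 1 : K[T;T⁻¹]) • y)
    (hdim : ∀ x, ∃ (c : K) (y : H), x - (C c : K[T;T⁻¹]) • s = (T 1 - 1 : K[T;T⁻¹]) • y)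
    (hs : ∀ y, s ≠ (T 1 - 1 : K[T;T⁻¹]) • y) :
    ∃ t, ψ t = t ∧ (∃ y, t - s = (T 1 - 1 : K[T;T⁻¹]) • y) ∧
      (∀ x, ∃ r : K[T;T⁻¹], ψ x = r • t) ∧ ∀ r : K[T;T⁻¹], r • t = 0 → r = 0 := by
  let N := LinearMap.range ψ
  have hN : ∀ x ∈ N, ψ x = x := by
    rintro _ ⟨x, rfl⟩
    exact hidem x
  -- On its image `ψ` is the identity, while it kills torsion. Being finitely generated over a
  -- principal ideal domain, the image is therefore free.
  have : Module.IsTorsionFree K[T;T⁻¹] N := Module.IsTorsionFree.of_smul_eq_zero fun f x h => by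
    by_contra! hne
    apply hne.2
    ext
    rw [← hN _ x.2]
    exact htors f _ hne.1 (congrArg Subtype.val h)
  let b := Module.Free.chooseBasis K[T;T⁻¹] N
  -- every element of `N` is a multiple of `ψ s` modulo `(T - 1) N`
  have hmod : ∀ x : N, ∃ (c : K) (y : N),
      x - (C c : K[T;T⁻¹]) • ψ.rangeRestrict s = (T 1 - 1 : K[T;T⁻¹]) • y := by
    intro x
    obtain ⟨c, y, h⟩ := hdim x
    refine ⟨c, ψ.rangeRestrict y, Subtype.ext ?_⟩
    simpa [hN _ x.2] using congrArg ψ h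
  choose c y hc using hmod
  -- Otherwise a basis vector would be divisible by `T - 1`.
  have hcne : ∀ i, c (b i) ≠ 0 := by
    intro i h0
    have := congrArg (fun x => b.repr x i) (hc (b i))
    simp only [h0, map_zero, zero_smul, sub_zero, map_smul, Finsupp.smul_apply, smul_eq_mul,
      Module.Basis.repr_self, Finsupp.single_eq_same] at this
    exact one_ne_zero (T_sub_one_mul_eq_C (c := (1 : K)) (by rw [← this, map_one]))
  have hsub : ∀ i j : Module.Free.ChooseBasisIndex K[T;T⁻¹] N, i = j := by
    intro i j
    by_contra hij
    -- This combination cancels `ψ s`, hence lies in `(T - 1) N`; its `i`-th coordinate is the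
    -- nonzero constant `c (b j)`, a contradiction.
    have h : (C (c (b j)) : K[T;T⁻¹]) • b i - (C (c (b i)) : K[T;T⁻¹]) • b j =
        (T 1 - 1 : K[T;T⁻¹]) • ((C (c (b j)) : K[T;T⁻¹]) • y (b i) -
          (C (c (b i)) : K[T;T⁻¹]) • y (b j)) := by
      rw [smul_sub, smul_comm (T 1 - 1 : K[T;T⁻¹]), ← hc, smul_comm (T 1 - 1 : K[T;T⁻¹]), ← hc]
      module
    have := congrArg (fun x => b.repr x i) h
    simp only [map_sub, map_smul, Finsupp.sub_apply, Finsupp.smul_apply, smul_eq_mul,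
      Module.Basis.repr_self, Finsupp.single_eq_same, Finsupp.single_eq_of_ne hij, mul_one,
      mul_zero, sub_zero] at this
    exact hcne j (T_sub_one_mul_eq_C this.symm)
  obtain ⟨i⟩ : Nonempty (Module.Free.ChooseBasisIndex K[T;T⁻¹] N) := by
    by_contra hempty
    rw [not_nonempty_iff] at hempty
    have : Subsingleton N := b.repr.toEquiv.subsingleton
    obtain ⟨y, hy⟩ := hfib s
    have h0 : ψ s = 0 := congrArg Subtype.val (Subsingleton.elim (ψ.rangeRestrict s) 0)
    exact hs (-y) (by rw [smul_neg, ← hy, h0]; abel)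
  have hb : ∀ x : N, x = b.repr x i • b i := by
    intro x
    apply b.repr.injective
    ext j
    simp [hsub j i]
  set e : K := c (b i)
  have hCe : (C e⁻¹ * C e : K[T;T⁻¹]) = 1 := by
    rw [← map_mul, inv_mul_cancel₀ (hcne i), map_one]
  -- Dividing the basis vector by `e` makes it agree with `ψ s`, hence with `s`, modulo `T - 1`.
  refine ⟨(C e⁻¹ : K[T;T⁻¹]) • (b i : H), ?_, ?_, ?_, ?_⟩
  · rw [map_smul, hN _ (b i).2]
  · obtain ⟨z, hz⟩ := hfib s
    have h := congrArg Subtype.val (hc (b i))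
    refine ⟨(C e⁻¹ : K[T;T⁻¹]) • (y (b i) : H) + z, ?_⟩
    rw [smul_add, smul_comm (T 1 - 1 : K[T;T⁻¹]), ← hz]
    have h' : ((T 1 - 1 : K[T;T⁻¹]) • (y (b i) : H)) = (b i : H) - (C e : K[T;T⁻¹]) • ψ s := h.symm
    rw [h', smul_sub, smul_smul, hCe, one_smul]
    abel
  · intro x
    refine ⟨b.repr (ψ.rangeRestrict x) i * C e, ?_⟩
    rw [smul_smul, mul_assoc, mul_comm (C e), hCe, mul_one]
    exact congrArg Subtype.val (hb (ψ.rangeRestrict x))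
  · intro r hr
    rw [smul_smul] at hr
    have h : (r * C e⁻¹) • b i = 0 := Subtype.ext hr
    have h2 := congrArg (fun x => b.repr x i) h
    simp only [map_smul, Finsupp.smul_apply, smul_eq_mul, Module.Basis.repr_self,
      Finsupp.single_eq_same, mul_one, map_zero, Finsupp.zero_apply] at h2
    rw [← mul_one r, ← hCe, ← mul_assoc, h2, zero_mul]

end Module

namespace OrbitAlgebra

variable {K : Type u} [Field K] {M : Type v} [AddCommGroup M] [Module K[T;T⁻¹] M]
  {V : Kˣ → Type w} [∀ g, AddCommGroup (V g)] [∀ g, Module K (V g)] (A : OrbitAlgebra K M V)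

/-- Being a coboundary in degree zero in the fibre at `g`. -/
def FibreExact (g : Kˣ) : Submodule K (V g) := (A.fibreDeg g (0 - 1)).map (A.fibreD g)

theorem ev_mem_fibreExact {g : Kˣ} {m : M} (hm : m ∈ A.boundaries 0) :
    A.ev g m ∈ A.FibreExact g := by
  obtain ⟨n, hn, rfl⟩ := hm
  exact ⟨A.ev g n, A.ev_mem g hn, (A.ev_d g n).symm⟩

theorem exists_eq_add_smul_of_fibreExact {g : Kˣ} {m : M} (hm : m ∈ Cocycles A.deg A.d 0)
    (h : A.ev g m ∈ A.FibreExact g) :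
    ∃ b ∈ A.boundaries 0, ∃ m' ∈ Cocycles A.deg A.d 0, m = b + (T 1 - C (g : K)) • m' := by
  obtain ⟨n, hn, hmn⟩ := h
  exact A.exists_eq_add_smul hm ⟨n, hn, hmn.symm⟩

theorem mem_cocycles_iff {i : ZMod 2} {m : M} :
    m ∈ Cocycles A.deg A.d i ↔ m ∈ A.deg i ∧ A.d m = 0 := Iff.rfl

variable [Infinite K]

/-! ### Products of cocycles -/

/-- Coefficientwise form of multiplication by `f(g z⁻¹)`: the monomial `c T ^ j` moves the index by
`j`. -/
theorem prod_smul_left (f : K[T;T⁻¹]) (b a : M) (k : ℤ) : A.prod (f • b) a k =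
    f.coeff.sum fun j c => (C c * T j : K[T;T⁻¹]) • A.prod b a (k + j) := by
  induction f using LaurentPolynomial.induction_on' with
  | add p q hp hq =>
    rw [add_smul, prod_add_left, Finsupp.add_apply, hp, hq, AddMonoidAlgebra.coeff_add,
      Finsupp.sum_add_index' (by simp) (by simp [add_mul, add_smul])]
  | C_mul_T n c =>
    have h : A.prod ((C c : K[T;T⁻¹]) • (T n : K[T;T⁻¹]) • b) a =
        (C c : K[T;T⁻¹]) • A.prod ((T n : K[T;T⁻¹]) • b) a :=
      A.evc_injective fun z g => by
        rw [evc_smul, evc_prod, evc_prod]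
        simp
    rw [mul_smul, h, prod_T_smul_left, ← LaurentPolynomial.single_eq_C_mul_T,
      AddMonoidAlgebra.coeff_single, Finsupp.sum_single_index (by simp), mul_smul,
      Finsupp.smul_apply, Finsupp.smul_apply]
    congr 2
    have := Finsupp.mapDomain_apply (add_left_injective (-n)) (A.prod b a) (k + n)
    rw [← this]
    simp [shift]

section Cocycles

variable {a b : M}

theorem prod_mem_cocycles (hb : b ∈ Cocycles A.deg A.d 0) (ha : a ∈ Cocycles A.deg A.d 0)
    (k : ℤ) : A.prod b a k ∈ Cocycles A.deg A.d 0 := by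
  refine A.mem_cocycles_iff.mpr ⟨A.prod_mem hb.1 ha.1 k, ?_⟩
  have h := DFunLike.congr_fun (A.prod_leibniz hb.1 ha.1) k
  simpa [(A.mem_cocycles_iff.mp hb).2, (A.mem_cocycles_iff.mp ha).2] using h

theorem prod_mem_boundaries_left (hb : b ∈ A.boundaries 0) (ha : a ∈ Cocycles A.deg A.d 0)
    (k : ℤ) : A.prod b a k ∈ A.boundaries 0 := by
  obtain ⟨η, hη, rfl⟩ := hb
  have h := DFunLike.congr_fun (A.prod_leibniz hη ha.1) k
  rw [(A.mem_cocycles_iff.mp ha).2, prod_zero_right, add_zero, sign_neg_one, neg_one_smul,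
    ← sub_eq_add_neg, Finsupp.sub_apply, dC_apply, Finsupp.zero_apply, sub_eq_zero] at h
  rw [← h]
  have := A.prod_mem hη ha.1 k
  rw [add_zero] at this
  exact A.d_mem_boundaries this

theorem prod_mem_boundaries_right (hb : b ∈ Cocycles A.deg A.d 0) (ha : a ∈ A.boundaries 0)
    (k : ℤ) : A.prod b a k ∈ A.boundaries 0 := by
  obtain ⟨η, hη, rfl⟩ := ha
  have h := DFunLike.congr_fun (A.prod_leibniz hb.1 hη) k
  rw [(A.mem_cocycles_iff.mp hb).2, prod_zero_left, smul_zero, add_zero, Finsupp.add_apply,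
    dC_apply, Finsupp.zero_apply, add_comm, ← eq_neg_iff_add_eq_zero] at h
  rw [h]
  have := A.prod_mem hb.1 hη k
  rw [zero_add] at this
  exact neg_mem (A.d_mem_boundaries this)

/-- The product with a torsion class vanishes. -/
theorem prod_mem_boundaries_of_torsion
    (ha : a ∈ Cocycles A.deg A.d 0) {f : K[T;T⁻¹]} (hf : f ≠ 0) (hfb : f • b ∈ A.boundaries 0)
    (k : ℤ) : A.prod b a k ∈ A.boundaries 0 := by
  by_contra hk
  classical
  let s := (A.prod b a).support.filter fun k => A.prod b a k ∉ A.boundaries 0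
  have hs : ∀ {k}, k ∈ s ↔ A.prod b a k ∉ A.boundaries 0 := by
    intro k
    refine Finset.mem_filter.trans (and_iff_right_of_imp fun h => ?_)
    rw [Finsupp.mem_support_iff]
    intro h0
    exact h (h0 ▸ zero_mem _)
  have hne : s.Nonempty := ⟨k, hs.mpr hk⟩
  have hsupp : f.coeff.support.Nonempty := by
    rw [Finsupp.support_nonempty_iff]
    exact fun h => hf (AddMonoidAlgebra.coeff_injective h)
  set N := s.max' hne
  set j₀ := f.coeff.support.min' hsupp
  -- `N` is the last index with a non-exact coefficient and `j₀` the lowest exponent of `f`. At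
  -- index `N - j₀` every other term involves an index beyond `N`, leaving a unit times the `N`-th
  -- coefficient.
  have h := A.prod_mem_boundaries_left hfb ha (N - j₀)
  rw [prod_smul_left, Finsupp.sum, ← Finset.add_sum_erase _ _ (f.coeff.support.min'_mem hsupp),
    Submodule.add_mem_iff_left _ (Submodule.sum_mem _ fun j hj => ?_), sub_add_cancel] at h
  · have hu : IsUnit (C (f.coeff j₀) * T j₀ : K[T;T⁻¹]) :=
      ((IsUnit.mk0 _ (Finsupp.mem_support_iff.mp (f.coeff.support.min'_mem hsupp))).map C).mul
        (LaurentPolynomial.isUnit_T j₀)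
    exact hs.mp (s.max'_mem hne) ((Submodule.smul_mem_iff_of_isUnit _ hu).mp h)
  · refine Submodule.smul_mem _ _ ?_
    by_contra hj'
    have h1 := s.le_max' _ (hs.mpr hj')
    have h2 := f.coeff.support.min'_le j (Finset.mem_of_mem_erase hj)
    have h3 := Finset.ne_of_mem_erase hj
    change N - j₀ + j ≤ N at h1
    change j₀ ≤ j at h2
    exact h3 (le_antisymm (by omega) h2)

theorem mulRight_mem_cocycles (hb : b ∈ Cocycles A.deg A.d 0) (ha : a ∈ Cocycles A.deg A.d 0) :
    A.mulRight a b ∈ Cocycles A.deg A.d 0 :=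
  total_mem (A.prod_mem_cocycles hb ha)

theorem mulRight_mem_boundaries (hb : b ∈ A.boundaries 0) (ha : a ∈ Cocycles A.deg A.d 0) :
    A.mulRight a b ∈ A.boundaries 0 :=
  total_mem (A.prod_mem_boundaries_left hb ha)

theorem mulRight_add (a m m' : M) : A.mulRight a (m + m') = A.mulRight a m + A.mulRight a m' := by
  rw [mulRight, prod_add_left, map_add, mulRight, mulRight]

/-- Right multiplication by `a` as a linear map. -/
def mulRightₗ (a : M) : M →ₗ[K[T;T⁻¹]] M where
  toFun := A.mulRight a
  map_add' := A.mulRight_add a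
  map_smul' := A.mulRight_smul a

/-- Right multiplication by a section depends only on the class of its value at `1`. -/
theorem mulRight_sub_mulRight_mem {a' : M} (hb : b ∈ Cocycles A.deg A.d 0)
    (ha : ∃ c ∈ A.boundaries 0, ∃ m ∈ Cocycles A.deg A.d 0,
      a' - a = c + (T 1 - 1 : K[T;T⁻¹]) • m) :
    A.mulRight a' b - A.mulRight a b ∈ A.boundaries 0 := by
  obtain ⟨c, hc, m, -, e⟩ := ha
  rw [mulRight, mulRight, ← map_sub, ← prod_sub_right, e, prod_add_right, map_add,
    total_prod_smul, add_zero]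
  exact total_mem (A.prod_mem_boundaries_right hb hc)

/-- The algebraic homotopy of `assoc_one` is essential: each coefficient must be exact over the
whole family, not merely in every fibre. -/
theorem mulRight_prod_sub_mem {c : M} (hc : c ∈ Cocycles A.deg A.d 0)
    (hb : b ∈ Cocycles A.deg A.d 0) (ha : a ∈ Cocycles A.deg A.d 0) (k : ℤ) :
    A.mulRight a (A.prod c b k) - A.prod c (A.mulRight a b) k ∈ A.boundaries 0 := by
  obtain ⟨n, hn, h⟩ := A.assoc_one hc.1 hb.1 ha.1 hc.2 hb.2 ha.2
  have e : (A.prod c b).mapRange (A.mulRightₗ a) (map_zero _) - A.prod c (A.mulRight a b) =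
      A.dC n := by
    refine A.evc_injective fun z g => ?_
    have h1 : g = g * 1 := (_root_.mul_one g).symm
    have h2 : z = z * 1 := (_root_.mul_one z).symm
    have h3 : g = g * z⁻¹ * z := (inv_mul_cancel_right g z).symm
    have h4 : A.evc z g ((A.prod c b).mapRange (A.mulRightₗ a) (map_zero _)) =
        A.mul h1 (A.evc z g (A.prod c b)) (A.ev 1 a) := by
      rw [evc_apply, evc_apply, Finsupp.sum_mapRange_index (by simp)]
      simp only [Finsupp.sum, map_sum, LinearMap.sum_apply, map_smul, LinearMap.smul_apply]
      exact Finset.sum_congr rfl fun k _ => congrArg _ (A.ev_mulRight a _ h1)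
    rw [map_sub, h4, ← A.mul_ev_ev h3, ← A.mul_ev_ev h3, A.ev_mulRight a b h2, h h3 h1 h2, dC,
      evc_apply, Finsupp.mapRange.linearMap_apply, Finsupp.sum_mapRange_index (by simp)]
  have := DFunLike.congr_fun e k
  rw [Finsupp.sub_apply, Finsupp.mapRange_apply, dC_apply] at this
  rw [show A.mulRight a (A.prod c b k) = A.mulRightₗ a (A.prod c b k) from rfl, this]
  exact A.d_mem_boundaries (hn k)

/-! ### The algebra structure on cohomology at a point -/

omit [Infinite K] in
theorem mul_mem {g₂ g₁ g : Kˣ} (h : g = g₂ * g₁) {i j : ZMod 2} {b : V g₂} {a : V g₁}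
    (hb : b ∈ A.fibreDeg g₂ i) (ha : a ∈ A.fibreDeg g₁ j) :
    A.mul h b a ∈ A.fibreDeg g (i + j) := by
  obtain ⟨b, hb', rfl⟩ := A.ev_surjective g₂ hb
  obtain ⟨a, ha', rfl⟩ := A.ev_surjective g₁ ha
  rw [mul_ev_ev, evc_apply]
  exact Submodule.sum_mem _ fun k _ => Submodule.smul_mem _ _ (A.ev_mem g (A.prod_mem hb' ha' k))

omit [Infinite K] in
theorem mul_mem_fibreExact_left {g₂ g₁ g : Kˣ} (h : g = g₂ * g₁) {b : V g₂} {a : V g₁}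
    (hb : b ∈ A.FibreExact g₂) (ha : a ∈ A.fibreDeg g₁ 0) (ha' : A.fibreD g₁ a = 0) :
    A.mul h b a ∈ A.FibreExact g := by
  obtain ⟨n, hn, rfl⟩ := hb
  have e := A.leibniz h hn ha
  rw [ha', map_zero, add_zero, sign_neg_one, neg_one_smul, ← sub_eq_add_neg, sub_eq_zero] at e
  have := A.mul_mem h hn ha
  rw [add_zero] at this
  exact ⟨_, this, e⟩

omit [Infinite K] in
theorem mul_mem_fibreExact_right {g₂ g₁ g : Kˣ} (h : g = g₂ * g₁) {b : V g₂} {a : V g₁}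
    (hb : b ∈ A.fibreDeg g₂ 0) (hb' : A.fibreD g₂ b = 0) (ha : a ∈ A.FibreExact g₁) :
    A.mul h b a ∈ A.FibreExact g := by
  obtain ⟨n, hn, rfl⟩ := ha
  have e := A.leibniz h hb hn
  rw [hb', map_zero, LinearMap.zero_apply, smul_zero, add_zero, add_comm,
    ← eq_neg_iff_add_eq_zero] at e
  rw [e]
  have := A.mul_mem h hb hn
  rw [zero_add] at this
  exact neg_mem ⟨_, this, rfl⟩

end Cocycles

end OrbitAlgebra

/-! ### A generator in degree zero and its multiplicativity -/

namespace OrbitAlgebra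

variable {K : Type u} [Field K] {M : Type v} [AddCommGroup M] [Module K[T;T⁻¹] M]
  {V : Kˣ → Type w} [∀ g, AddCommGroup (V g)] [∀ g, Module K (V g)] (A : OrbitAlgebra K M V)

/-- The class of a cocycle of degree zero. -/
def cls : Cocycles A.deg A.d 0 →ₗ[K[T;T⁻¹]] Cohomology A.deg A.d 0 := Submodule.mkQ _

theorem cls_eq {m m' : Cocycles A.deg A.d 0} :
    A.cls m = A.cls m' ↔ (m : M) - m' ∈ A.boundaries 0 :=
  Submodule.Quotient.eq _

theorem cls_surjective (x : Cohomology A.deg A.d 0) : ∃ m, A.cls m = x :=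
  Submodule.Quotient.mk_surjective _ x

variable [Infinite K]

/-- Right multiplication by the value at `1` of a cocycle, as an endomorphism of `H⁰`. -/
def mulRightCohomology {a : M} (ha : a ∈ Cocycles A.deg A.d 0) :
    Cohomology A.deg A.d 0 →ₗ[K[T;T⁻¹]] Cohomology A.deg A.d 0 :=
  Submodule.mapQ _ _ ((A.mulRightₗ a).restrict fun _ hm => A.mulRight_mem_cocycles hm ha)
    fun _ hm => A.mulRight_mem_boundaries hm ha

theorem mulRightCohomology_cls {a : M} (ha : a ∈ Cocycles A.deg A.d 0)
    (m : Cocycles A.deg A.d 0) : A.mulRightCohomology ha (A.cls m) =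
      A.cls ⟨A.mulRight a m, A.mulRight_mem_cocycles m.2 ha⟩ := rfl

variable {σ : M} (hσ : σ ∈ Cocycles A.deg A.d 0) (hσ1 : A.ev 1 σ = A.one)

include hσ hσ1

theorem mulRight_sub_self {m : M} (hm : m ∈ Cocycles A.deg A.d 0) :
    ∃ b ∈ A.boundaries 0, ∃ m' ∈ Cocycles A.deg A.d 0,
      A.mulRight σ m - m = b + (T 1 - 1 : K[T;T⁻¹]) • m' :=
  A.mulRight_sub_self_of_firstOrder (w := 0) hσ.1
    (by rw [(A.mem_cocycles_iff.mp hσ).2, smul_zero]) hσ1 hm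

/-- By associativity, multiplying twice by `σ` is multiplying by `mulRight σ σ`, which differs from
`σ` by a coboundary and a multiple of `T - 1`; right multiplication at `1` does not see such a
difference. -/
theorem mulRight_mulRight_sub_mem {m : M} (hm : m ∈ Cocycles A.deg A.d 0) :
    A.mulRight σ (A.mulRight σ m) - A.mulRight σ m ∈ A.boundaries 0 := by
  have h1 := A.mulRight_sub_mulRight_mem hm (A.mulRight_sub_self hσ hσ1 hσ)
  have h2 : A.mulRight σ (A.mulRight σ m) - A.mulRight (A.mulRight σ σ) m ∈ A.boundaries 0 := by
    have h : A.mulRight σ (A.mulRight σ m) = total K M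
        ((A.prod m σ).mapRange (A.mulRightₗ σ) (map_zero _)) := by
      rw [total, Finsupp.lsum_apply, Finsupp.sum_mapRange_index (by simp)]
      change A.mulRightₗ σ (total K M (A.prod m σ)) = _
      rw [total, Finsupp.lsum_apply, Finsupp.sum, map_sum]
      rfl
    rw [h, mulRight, ← map_sub]
    exact total_mem fun k => A.mulRight_prod_sub_mem hm hσ hσ k
  simpa using add_mem h2 h1

/-- `exists_generator_of_idempotent` applies to right multiplication by `σ` on `H⁰`. The fibre of
`H⁰` at `1` embeds in the cohomology of the fibre complex, so simplicity bounds it by the line of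
`σ`, and non-exactness of the unit makes this line nonzero. -/
theorem exists_generator [Module.Finite K[T;T⁻¹] (Cohomology A.deg A.d 0)]
    (hdim : ∀ v ∈ A.fibreDeg 1 0, A.fibreD 1 v = 0 → ∃ c : K, v - c • A.one ∈ A.FibreExact 1)
    (hone : A.one ∉ A.FibreExact 1) :
    ∃ ρ ∈ Cocycles A.deg A.d 0, A.mulRight σ ρ - ρ ∈ A.boundaries 0 ∧
      (∃ b ∈ A.boundaries 0, ∃ m ∈ Cocycles A.deg A.d 0,
        ρ - σ = b + (T 1 - 1 : K[T;T⁻¹]) • m) ∧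
      (∀ m ∈ Cocycles A.deg A.d 0, ∃ r : K[T;T⁻¹], A.mulRight σ m - r • ρ ∈ A.boundaries 0) ∧
      ∀ r : K[T;T⁻¹], r • ρ ∈ A.boundaries 0 → r = 0 := by
  have h₁ : ∀ (f : K[T;T⁻¹]) x, f ≠ 0 → f • x = 0 → A.mulRightCohomology hσ x = 0 := by
    intro f x hf hfx
    obtain ⟨⟨m, hm⟩, rfl⟩ := A.cls_surjective x
    rw [← map_smul, ← map_zero A.cls, cls_eq] at hfx
    simp only [Submodule.coe_smul, ZeroMemClass.coe_zero, sub_zero] at hfx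
    rw [mulRightCohomology_cls, ← map_zero A.cls, cls_eq]
    rw [ZeroMemClass.coe_zero, sub_zero]
    exact total_mem (A.prod_mem_boundaries_of_torsion hσ hf hfx)
  have h₂ : ∀ x, A.mulRightCohomology hσ (A.mulRightCohomology hσ x) =
      A.mulRightCohomology hσ x := by
    intro x
    obtain ⟨⟨m, hm⟩, rfl⟩ := A.cls_surjective x
    exact A.cls_eq.mpr (A.mulRight_mulRight_sub_mem hσ hσ1 hm)
  have h₃ : ∀ x, ∃ y, A.mulRightCohomology hσ x - x = (T 1 - 1 : K[T;T⁻¹]) • y := by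
    intro x
    obtain ⟨⟨m, hm⟩, rfl⟩ := A.cls_surjective x
    obtain ⟨b, hb, m', hm', e⟩ := A.mulRight_sub_self hσ hσ1 hm
    refine ⟨A.cls ⟨m', hm'⟩, ?_⟩
    rw [mulRightCohomology_cls, ← map_sub, ← map_smul, cls_eq, Submodule.coe_smul,
      Submodule.coe_sub]
    rwa [e, add_sub_cancel_right]
  have h₄ : ∀ x, ∃ (c : K) (y : Cohomology A.deg A.d 0),
      x - (C c : K[T;T⁻¹]) • A.cls ⟨σ, hσ⟩ = (T 1 - 1 : K[T;T⁻¹]) • y := by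
    intro x
    obtain ⟨⟨m, hm⟩, rfl⟩ := A.cls_surjective x
    obtain ⟨c, hc⟩ := hdim (A.ev 1 m) (A.ev_mem 1 hm.1)
      (by rw [← ev_d, (A.mem_cocycles_iff.mp hm).2, map_zero])
    obtain ⟨b, hb, m', hm', e⟩ := A.exists_eq_add_smul_of_fibreExact (g := 1)
      (m := m - (C c : K[T;T⁻¹]) • σ) (sub_mem hm (Submodule.smul_mem _ _ hσ))
      (by simpa [hσ1] using hc)
    refine ⟨c, A.cls ⟨m', hm'⟩, ?_⟩
    rw [← map_smul, ← map_smul, ← map_sub, cls_eq]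
    simp only [Submodule.coe_smul, Submodule.coe_sub]
    simpa [e] using hb
  have h₅ : ∀ y, A.cls ⟨σ, hσ⟩ ≠ (T 1 - 1 : K[T;T⁻¹]) • y := by
    intro y hy
    obtain ⟨⟨m, hm⟩, rfl⟩ := A.cls_surjective y
    rw [← map_smul, cls_eq] at hy
    have h := A.ev_mem_fibreExact (g := 1) hy
    apply hone
    simpa [hσ1] using h
  obtain ⟨t, ht, ⟨y, hy⟩, hgen, htors⟩ := exists_generator_of_idempotent
    (A.mulRightCohomology hσ) (A.cls ⟨σ, hσ⟩) h₁ h₂ h₃ h₄ h₅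
  obtain ⟨⟨ρ, hρ⟩, rfl⟩ := A.cls_surjective t
  obtain ⟨⟨m, hm⟩, rfl⟩ := A.cls_surjective y
  rw [← map_sub, ← map_smul] at hy
  refine ⟨ρ, hρ, A.cls_eq.mp ht, ⟨_, A.cls_eq.mp hy, m, hm, (sub_add_cancel _ _).symm⟩,
    fun x hx => ?_, fun r hr => htors r ?_⟩
  · obtain ⟨r, h⟩ := hgen (A.cls ⟨x, hx⟩)
    rw [mulRightCohomology_cls, ← map_smul] at h
    exact ⟨r, A.cls_eq.mp h⟩
  · rw [← map_smul, ← map_zero A.cls, cls_eq]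
    simpa using hr

/-- The unit extends to a section which is multiplicative up to an algebraic homotopy. -/
theorem exists_multiplicative [Module.Finite K[T;T⁻¹] (Cohomology A.deg A.d 0)]
    (hdim : ∀ v ∈ A.fibreDeg 1 0, A.fibreD 1 v = 0 → ∃ c : K, v - c • A.one ∈ A.FibreExact 1)
    (hone : A.one ∉ A.FibreExact 1) :
    ∃ ρ ∈ Cocycles A.deg A.d 0, A.ev 1 ρ - A.one ∈ A.FibreExact 1 ∧
      ∃ c : ℤ →₀ M, (∀ k, c k ∈ A.deg (0 - 1)) ∧
        A.prod ρ ρ = Finsupp.single 0 ρ + A.dC c := by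
  obtain ⟨ρ, hρ, hψρ, hρσ, hgen, htors⟩ := A.exists_generator hσ hσ1 hdim hone
  refine ⟨ρ, hρ, ?_, ?_⟩
  · obtain ⟨b, hb, m, -, e⟩ := hρσ
    rw [← hσ1, ← map_sub, e, map_add, map_smulₛₗ]
    simpa using A.ev_mem_fibreExact (g := 1) hb
  have hclosed : ∀ g, A.fibreD g (A.ev g ρ) = 0 := fun g => by
    rw [← ev_d, (A.mem_cocycles_iff.mp hρ).2, map_zero]
  -- the product is a multiple of `ρ`
  have hcoef : ∀ k, ∃ r : K[T;T⁻¹], A.prod ρ ρ k - r • ρ ∈ A.boundaries 0 := by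
    intro k
    obtain ⟨r, hr⟩ := hgen _ (A.prod_mem_cocycles hρ hρ k)
    -- Right multiplication by `σ` fixes the class of the coefficient, since it can be moved onto
    -- the right factor `ρ`, whose class it fixes. So the coefficient lies in the rank one image.
    have h1 := A.mulRight_prod_sub_mem hρ hρ hσ k
    have h2 := A.prod_mem_boundaries_right hρ hψρ k
    rw [prod_sub_right, Finsupp.sub_apply] at h2
    refine ⟨r, ?_⟩
    have := sub_mem (sub_mem hr h1) h2
    convert this using 1
    abel
  choose r hr using hcoef
  -- The support is finite because `ρ` is torsion-free: a zero coefficient forces `r k = 0`.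
  let f : ℤ →₀ K[T;T⁻¹] := Finsupp.onFinset (A.prod ρ ρ).support r fun k hk => by
    rw [Finsupp.mem_support_iff]
    intro h0
    have := hr k
    rw [h0, zero_sub, neg_mem_iff] at this
    exact hk (htors _ this)
  let fρ : ℤ →₀ M := f.mapRange (fun r => r • ρ) (zero_smul _ _)
  have hf : ∀ k, (A.prod ρ ρ - fρ) k ∈ A.boundaries 0 := hr
  let q : Kˣ → Kˣ → K := fun x z => f.sum fun k p => ((z ^ k : Kˣ) : K) * evalAt (x * z) p
  have hq : ∀ {x z g : Kˣ} (h : g = x * z),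
      A.mul h (A.ev x ρ) (A.ev z ρ) - q x z • A.ev g ρ ∈ A.FibreExact g := by
    intro x z g h
    have h2 : q x z • A.ev g ρ = A.evc z g fρ := by
      rw [evc_apply, Finsupp.sum_mapRange_index (by simp)]
      simp [q, ← h, Finsupp.sum, Finset.sum_smul, mul_smul]
    rw [mul_ev_ev, h2, ← map_sub, evc_apply]
    exact Submodule.sum_mem _ fun k _ => Submodule.smul_mem _ _ (A.ev_mem_fibreExact (hf k))
  -- The class of `ρ` is nonzero in every fibre. If it vanished at `g`, `ρ` would be a multiple of
  -- `T - g` in cohomology; right multiplication by `σ` turns the cofactor into `s ρ`, whence `1 =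
  -- (T - g) s`, absurd at `g`.
  have hne : ∀ (g : Kˣ) (c : K), c • A.ev g ρ ∈ A.FibreExact g → c = 0 := by
    intro g c hc
    by_contra hc0
    obtain ⟨b, hb, m, hm, e⟩ := A.exists_eq_add_smul_of_fibreExact hρ
      (((A.FibreExact g).smul_mem_iff hc0).mp hc)
    obtain ⟨s, hs⟩ := hgen m hm
    have hb' := A.mulRight_mem_boundaries hb hσ
    have h := htors (1 - (T 1 - C (g : K)) * s) (by
      have e2 : (1 - (T 1 - C (g : K)) * s) • ρ = A.mulRight σ b +
          (T 1 - C (g : K)) • (A.mulRight σ m - s • ρ) - (A.mulRight σ ρ - ρ) := by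
        have e3 : A.mulRight σ ρ = A.mulRight σ b + (T 1 - C (g : K)) • A.mulRight σ m := by
          conv_lhs => rw [e]
          rw [mulRight_add, mulRight_smul]
        rw [e3]
        module
      rw [e2]
      exact sub_mem (add_mem hb' (Submodule.smul_mem _ _ hs)) hψρ)
    simpa using congrArg (evalAt g) h
  -- Setting `z = 1` gives right multiplication by the value of `ρ` at `1`, which acts like that of
  -- `σ` and so fixes the class of `ρ`.
  have hq1 : ∀ x, q x 1 = 1 := by
    have h1 : total K M fρ - ρ ∈ A.boundaries 0 := by
      have h2 := total_mem hf
      rw [map_sub] at h2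
      have h3 := A.mulRight_sub_mulRight_mem hρ hρσ
      have := sub_mem (add_mem h3 hψρ) h2
      rw [mulRight] at this
      convert this using 1
      abel
    have h2 : total K M fρ = (f.sum fun _ p => p) • ρ := by
      rw [total, Finsupp.lsum_apply, Finsupp.sum_mapRange_index (by simp), Finsupp.sum, Finsupp.sum,
        Finset.sum_smul]
      rfl
    have h3 := htors ((f.sum fun _ p => p) - 1) (by rwa [sub_smul, one_smul, ← h2])
    intro x
    have := congrArg (evalAt x) (sub_eq_zero.mp h3)
    simpa [q, Finsupp.sum] using this
  -- Both bracketings of `ρ_x ρ_x ρ_z` are multiples of the nonzero class of `ρ`; associativity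
  -- equates the scalars.
  have hassoc : ∀ x z, q x x * q (x * x) z = q x (x * z) * q x z := by
    intro x z
    have h' : x * x * z = x * (x * z) := mul_assoc x x z
    obtain ⟨n, hn, e⟩ := A.assoc rfl rfl rfl h' (A.ev_mem x hρ.1) (A.ev_mem x hρ.1)
      (A.ev_mem z hρ.1) (hclosed x) (hclosed x) (hclosed z)
    have he : A.fibreD (x * x * z) n ∈ A.FibreExact (x * x * z) := ⟨n, hn, rfl⟩
    have h1 := A.mul_mem_fibreExact_left rfl (hq (x := x) (z := x) rfl) (A.ev_mem z hρ.1)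
      (hclosed z)
    have h2 := A.mul_mem_fibreExact_right h' (A.ev_mem x hρ.1) (hclosed x)
      (hq (x := x) (z := z) rfl)
    have h3 := Submodule.smul_mem _ (q x x) (hq (x := x * x) (z := z) rfl)
    have h4 := Submodule.smul_mem _ (q x z) (hq h')
    rw [← e] at he
    rw [← sub_eq_zero]
    refine hne (x * x * z) _ ?_
    have := sub_mem (sub_mem (add_mem he h2) (add_mem h1 h3)) (neg_mem h4)
    simp only [map_sub, map_smul, LinearMap.sub_apply, LinearMap.smul_apply] at this
    convert this using 1
    module
  have hf1 := eq_single_of_cocycle f q (fun _ _ => rfl) hq1 hassoc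
  have hfρ : fρ = Finsupp.single 0 ρ := by
    change f.mapRange _ _ = _
    simp [hf1]
  rw [hfρ] at hf
  choose c hc hc' using hf
  classical
  let e : ℤ →₀ M := A.prod ρ ρ - Finsupp.single 0 ρ
  -- The chosen primitives are replaced by `0` where the coefficient is already zero, to keep the
  -- support finite.
  refine ⟨Finsupp.onFinset e.support (fun k => if e k = 0 then 0 else c k) fun k hk => ?_,
    fun k => ?_, ?_⟩
  · rw [Finsupp.mem_support_iff]
    intro h0
    exact hk (if_pos h0)
  · rw [Finsupp.onFinset_apply]
    split_ifs
    exacts [zero_mem _, hc k]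
  · rw [← sub_eq_iff_eq_add']
    ext k
    rw [dC_apply, Finsupp.onFinset_apply]
    split_ifs with h
    · rw [map_zero]
      exact h
    · exact (hc' k).symm

end OrbitAlgebra

/-! ## The lowest `A_∞`-relations -/

namespace AInftyCategory

variable {K : Type u} [Field K] {Ob : Type v} (A : AInftyCategory.{u, v, w} K Ob)

theorem μ_zero {X Y Z W : Ob} {d e : ℕ} (p : Chain A.Hom X Y d) (q : Chain A.Hom Z W e) :
    A.μ ((p.cons (0 : A.Hom Y Z)).comp q) = 0 := by
  have := A.μ_smul p (0 : K) (0 : A.Hom Y Z) q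
  rwa [zero_smul, zero_smul] at this

theorem leibniz {X Y Z : Ob} {i j : ZMod 2} {a : A.Hom X Y} {b : A.Hom Y Z}
    (ha : a ∈ A.deg X Y j) (hb : b ∈ A.deg Y Z i) :
    A.differential X Z (A.μ (((Chain.nil X).cons a).cons b)) +
      A.μ (((Chain.nil X).cons (A.differential X Y a)).cons b) +
      sign (j - 1) • A.μ (((Chain.nil X).cons a).cons (A.differential Y Z b)) = 0 := by
  have h := A.relation (((Chain.nil X).cons (⟨j, a, ha⟩ : A.toGradedQuiver.Homog X Y)).cons
    (⟨i, b, hb⟩ : A.toGradedQuiver.Homog Y Z))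
  have h0 : A.μ ((((Chain.nil X).cons (0 : A.Hom X X)).cons a).cons b) = 0 :=
    A.μ_zero (Chain.nil X) (((Chain.nil X).cons a).cons b)
  have h1 : A.μ ((((Chain.nil X).cons a).cons (0 : A.Hom Y Y)).cons b) = 0 :=
    A.μ_zero ((Chain.nil X).cons a) ((Chain.nil Y).cons b)
  have h2 : A.μ ((((Chain.nil X).cons a).cons b).cons (0 : A.Hom Z Z)) = 0 :=
    A.μ_zero (((Chain.nil X).cons a).cons b) (Chain.nil Z)
  have hs : sign 0 = 1 := rfl
  simp only [Chain.splits, GradedQuiver.forget, Chain.map, Chain.comp, GradedQuiver.reducedDegree,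
    List.map_cons, List.map_nil, List.flatMap_cons, List.flatMap_nil, List.cons_append,
    List.nil_append, List.sum_cons, List.sum_nil, A.μ_nil, h0, h1, h2, smul_zero, hs,
    one_smul, add_zero, zero_add] at h
  have hd : ∀ (X Y : Ob) (x : A.Hom X Y), A.differential X Y x = A.μ ((Chain.nil X).cons x) :=
    fun _ _ _ => rfl
  rw [hd, hd, hd, ← h]
  abel

/-- The relation of length three on cocycles of degree `0`. Only the terms nesting `μ²` and the
differential of `μ³` survive; the reduced degree `-1` of `a` gives the minus sign. -/
theorem associativity {X Y Z W : Ob} {a : A.Hom X Y} {b : A.Hom Y Z} {c : A.Hom Z W}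
    (ha : a ∈ A.deg X Y 0) (hb : b ∈ A.deg Y Z 0) (hc : c ∈ A.deg Z W 0)
    (ha' : A.differential X Y a = 0) (hb' : A.differential Y Z b = 0)
    (hc' : A.differential Z W c = 0) :
    A.μ (((Chain.nil X).cons a).cons (A.μ (((Chain.nil Y).cons b).cons c))) -
      A.μ (((Chain.nil X).cons (A.μ (((Chain.nil X).cons a).cons b))).cons c) =
      A.differential X W (A.μ ((((Chain.nil X).cons a).cons b).cons c)) := by
  have h := A.relation ((((Chain.nil X).cons (⟨0, a, ha⟩ : A.toGradedQuiver.Homog X Y)).cons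
    (⟨0, b, hb⟩ : A.toGradedQuiver.Homog Y Z)).cons (⟨0, c, hc⟩ : A.toGradedQuiver.Homog Z W))
  have h0 : A.μ (((((Chain.nil X).cons (0 : A.Hom X X)).cons a).cons b).cons c) = 0 :=
    A.μ_zero (Chain.nil X) ((((Chain.nil X).cons a).cons b).cons c)
  have h1 : A.μ (((((Chain.nil X).cons a).cons (0 : A.Hom Y Y)).cons b).cons c) = 0 :=
    A.μ_zero ((Chain.nil X).cons a) (((Chain.nil Y).cons b).cons c)
  have h2 : A.μ (((((Chain.nil X).cons a).cons b).cons (0 : A.Hom Z Z)).cons c) = 0 :=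
    A.μ_zero (((Chain.nil X).cons a).cons b) ((Chain.nil Z).cons c)
  have h3 : A.μ (((((Chain.nil X).cons a).cons b).cons c).cons (0 : A.Hom W W)) = 0 :=
    A.μ_zero ((((Chain.nil X).cons a).cons b).cons c) (Chain.nil W)
  have h4 : A.μ ((((Chain.nil X).cons (0 : A.Hom X Y)).cons b).cons c) = 0 :=
    A.μ_zero (Chain.nil X) (((Chain.nil Y).cons b).cons c)
  have h5 : A.μ ((((Chain.nil X).cons a).cons (0 : A.Hom Y Z)).cons c) = 0 :=
    A.μ_zero ((Chain.nil X).cons a) ((Chain.nil Z).cons c)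
  have h6 : A.μ ((((Chain.nil X).cons a).cons b).cons (0 : A.Hom Z W)) = 0 :=
    A.μ_zero (((Chain.nil X).cons a).cons b) (Chain.nil W)
  change A.μ ((Chain.nil X).cons a) = 0 at ha'
  change A.μ ((Chain.nil Y).cons b) = 0 at hb'
  change A.μ ((Chain.nil Z).cons c) = 0 at hc'
  have hs : sign 0 = 1 := rfl
  have hs' : sign (0 - 1) = -1 := rfl
  simp only [Chain.splits, GradedQuiver.forget, Chain.map, Chain.comp, GradedQuiver.reducedDegree,
    List.map_cons, List.map_nil, List.flatMap_cons, List.flatMap_nil, List.cons_append,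
    List.nil_append, List.sum_cons, List.sum_nil, A.μ_nil, h0, h1, h2, h3, ha', hb', hc', h4, h5,
    h6, smul_zero, hs, hs', neg_smul, one_smul, add_zero, zero_add] at h
  change _ = A.μ _
  rw [← sub_eq_zero, ← neg_eq_zero, ← h]
  abel

/-- Transport of morphisms along an equality of source objects. -/
def transport {S S' Y : Ob} (h : S = S') : A.Hom S' Y ≃ₗ[K] A.Hom S Y :=
  h ▸ LinearEquiv.refl K _

variable {S S' Z Z' W W' Y : Ob}

@[simp] theorem transport_rfl (a : A.Hom S Y) : A.transport rfl a = a := rfl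

theorem transport_transport {S'' : Ob} (h : S = S') (h' : S' = S'') (a : A.Hom S'' Y) :
    A.transport h (A.transport h' a) = A.transport (h.trans h') a := by
  subst h; rfl

theorem differential_transport (h : S = S') (a : A.Hom S' Y) :
    A.differential S Y (A.transport h a) = A.transport h (A.differential S' Y a) := by
  subst h; rfl

theorem transport_mem (h : S = S') {i : ZMod 2} {a : A.Hom S' Y} (ha : a ∈ A.deg S' Y i) :
    A.transport h a ∈ A.deg S Y i := by
  subst h; exact ha

/-- The hypothesis on `a` is a heterogeneous equality because strict actions respect the group law
only in that form. -/
theorem μ_transport (hS : S = S') (hZ : Z = Z') {a : A.Hom S Z} {a' : A.Hom S' Z'}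
    (ha : HEq a a') (b : A.Hom Z' Y) :
    A.μ (((Chain.nil S).cons a).cons (A.transport hZ b)) =
      A.transport hS (A.μ (((Chain.nil S').cons a').cons b)) := by
  subst hS hZ
  rw [eq_of_heq ha]
  rfl

end AInftyCategory

/-! ### Strict actions and values of sections over powers of the group -/

namespace StrictAction

variable {K : Type u} [Field K] {Ob : Type v} [MulAction Kˣ Ob]
  {A : AInftyCategory.{u, v, w} K Ob} (σ : StrictAction A)

theorem differential_act (g : Kˣ) {X Y : Ob} (a : A.Hom X Y) :
    A.differential (g • X) (g • Y) (σ.act g a) = σ.act g (A.differential X Y a) :=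
  (σ.act_μ g ((Chain.nil X).cons a)).symm

theorem heq_act_transport (g : Kˣ) {S S' Y : Ob} (h : S = S') (a : A.Hom S' Y) :
    HEq (σ.act g (A.transport h a)) (σ.act g a) := by
  subst h; rfl

end StrictAction

namespace CoordRing

variable {K : Type u} [Field K] {d : ℕ}

/-- The monomial `c T_1^{e_1} ⋯ T_d^{e_d}`. -/
def monomial (e : Fin d → ℤ) (c : K) : CoordRing K d :=
  (AddMonoidAlgebra.single e c : AddMonoidAlgebra K (Fin d → ℤ))

theorem evalMulti_monomial (g : Fin d → Kˣ) (e : Fin d → ℤ) (c : K) :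
    evalMulti g (monomial e c) = c * ((∏ i, g i ^ e i : Kˣ) : K) :=
  evalMulti_single g e c

theorem induction {P : CoordRing K d → Prop} (b : CoordRing K d) (zero : P 0)
    (add : ∀ p q, P p → P q → P (p + q)) (mono : ∀ e c, P (monomial e c)) : P b :=
  AddMonoidAlgebra.induction_linear (motive := P) b zero add mono

end CoordRing

namespace EquivariantFamily

variable {K : Type u} [Field K] {Ob : Type v} [MulAction Kˣ Ob]
  {A : AInftyCategory.{u, v, w} K Ob} (F : EquivariantFamily.{u, v, w, u'} A)

theorem value_eq_transport (g : Kˣ) {S X Y : Ob} (h : S = g • X) (a : F.Hom X Y) :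
    F.value g h a = A.transport h (F.ev g a) := by
  subst h; rfl

theorem value_congr {g g' : Kˣ} (hg : g' = g) {S X Y : Ob} (h : S = g' • X) (h' : S = g • X)
    (a : F.Hom X Y) : F.value g' h a = F.value g h' a := by
  subst hg; rfl

theorem multiValue_tmul {d : ℕ} (g : Fin d → Kˣ) {S X Y : Ob} (h : S = (∏ i, g i) • X)
    (b : CoordRing K d) (a : F.Hom X Y) :
    F.multiValue g h (b ⊗ₜ a) = evalMulti g b • F.value (∏ i, g i) h a := rfl

theorem multiValue_transport {d : ℕ} (g : Fin d → Kˣ) {S S' X Y : Ob} (hS : S = S')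
    (h : S' = (∏ i, g i) • X) (x : CoordRing K d ⊗[K[T;T⁻¹]] F.Hom X Y) :
    F.multiValue g (hS.trans h) x = A.transport hS (F.multiValue g h x) := by
  subst hS; rfl

/-- A section over `𝔾_m^d`, restricted to a two-parameter family `G`, expanded in powers of one of
the parameters. -/
theorem exists_expansion {d : ℕ} (G : Kˣ → Kˣ → Fin d → Kˣ) (hG : ∀ z g, ∏ i, G z g i = g)
    (l m : (Fin d → ℤ) → ℤ) (hlm : ∀ z g e, ∏ i, G z g i ^ e i = z ^ l e * g ^ m e) {X Y : Ob}
    {N : Type*} [AddCommGroup N] [Module K[T;T⁻¹] N] (φ : N →ₗ[K[T;T⁻¹]] F.Hom X Y)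
    (x : CoordRing K d ⊗[K[T;T⁻¹]] N) :
    ∃ n : ℤ →₀ N, ∀ (z g : Kˣ) (h : g • X = (∏ i, G z g i) • X),
      F.multiValue (G z g) h (LinearMap.lTensor _ φ x) =
        n.sum fun k y => ((z ^ k : Kˣ) : K) • F.ev g (φ y) := by
  have hadd : ∀ x y : CoordRing K d ⊗[K[T;T⁻¹]] N,
      (∃ n : ℤ →₀ N, ∀ (z g : Kˣ) (h : g • X = (∏ i, G z g i) • X),
        F.multiValue (G z g) h (LinearMap.lTensor _ φ x) =
          n.sum fun k y => ((z ^ k : Kˣ) : K) • F.ev g (φ y)) →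
      (∃ n : ℤ →₀ N, ∀ (z g : Kˣ) (h : g • X = (∏ i, G z g i) • X),
        F.multiValue (G z g) h (LinearMap.lTensor _ φ y) =
          n.sum fun k y => ((z ^ k : Kˣ) : K) • F.ev g (φ y)) →
      ∃ n : ℤ →₀ N, ∀ (z g : Kˣ) (h : g • X = (∏ i, G z g i) • X),
        F.multiValue (G z g) h (LinearMap.lTensor _ φ (x + y)) =
          n.sum fun k y => ((z ^ k : Kˣ) : K) • F.ev g (φ y) := by
    rintro x y ⟨n, hn⟩ ⟨n', hn'⟩
    refine ⟨n + n', fun z g h => ?_⟩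
    rw [map_add, map_add, hn, hn', Finsupp.sum_add_index' (by simp) (by simp)]
  have hzero : ∃ n : ℤ →₀ N, ∀ (z g : Kˣ) (h : g • X = (∏ i, G z g i) • X),
      F.multiValue (G z g) h (LinearMap.lTensor _ φ 0) =
        n.sum fun k y => ((z ^ k : Kˣ) : K) • F.ev g (φ y) := ⟨0, by simp⟩
  induction x using TensorProduct.induction_on with
  | zero => exact hzero
  | add x y hx hy => exact hadd x y hx hy
  | tmul b y =>
    induction b using CoordRing.induction with
    | zero => rwa [TensorProduct.zero_tmul]
    | add p q hp hq =>
      rw [TensorProduct.add_tmul]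
      exact hadd _ _ hp hq
    | mono e c =>
      -- The monomial restricts to `c z ^ l g ^ m`; the power of `g` is absorbed into the section as
      -- `T (m e)`.
      refine ⟨Finsupp.single (l e) ((C c * T (m e) : K[T;T⁻¹]) • y), fun z g h => ?_⟩
      rw [LinearMap.lTensor_tmul, multiValue_tmul, CoordRing.evalMulti_monomial,
        F.value_congr (hG z g) h rfl, hlm, Finsupp.sum_single_index (by simp), map_smul,
        map_smulₛₗ, smul_smul, map_mul, evalAt_C, evalAt_T]
      change _ • F.ev g (φ y) = _
      congr 1
      push_cast
      ring

end EquivariantFamily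

/-! ### Products and associativity along an orbit -/

namespace RationalAction

variable {K : Type u} [Field K] {Ob : Type v} [MulAction Kˣ Ob]
  {A : AInftyCategory.{u, v, w} K Ob} (R : RationalAction.{u, v, w, u'} A)

/-- Evaluation preserves degrees and the degree pieces of each fibre are independent, so both
homogeneous components have vanishing values. -/
theorem ev_injective [Infinite K] {X Y : Ob} {a : R.family.Hom X Y}
    (h : ∀ g : Kˣ, R.family.ev g a = 0) : a = 0 := by
  have htop : R.family.deg X Y 0 ⊔ R.family.deg X Y 1 = ⊤ := by
    rw [eq_top_iff, ← (R.family.isInternal X Y).submodule_iSup_eq_top]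
    refine iSup_le fun i => ?_
    fin_cases i
    exacts [le_sup_left, le_sup_right]
  obtain ⟨b, hb, c, hc, rfl⟩ := Submodule.mem_sup.mp (htop ▸ Submodule.mem_top (x := a))
  have hbc : ∀ g : Kˣ, R.family.ev g b = 0 ∧ R.family.ev g c = 0 := by
    intro g
    have hg : R.family.ev g b = -R.family.ev g c :=
      eq_neg_of_add_eq_zero_left (by rw [← map_add, h])
    have hdisj : Disjoint (A.deg (g • X) Y 0) (A.deg (g • X) Y 1) :=
      (A.isInternal (g • X) Y).submodule_iSupIndep.pairwiseDisjoint (by decide)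
    have hb0 := Submodule.disjoint_def.mp hdisj _ (R.ev_mem g 0 b hb)
      (hg ▸ neg_mem (R.ev_mem g 1 c hc))
    refine ⟨hb0, ?_⟩
    rwa [hb0, eq_comm, neg_eq_zero] at hg
  rw [R.eq_zero_of_ev hb fun g => (hbc g).1, R.eq_zero_of_ev hc fun g => (hbc g).2, add_zero]

variable (X : Ob)

/-- The product `hom(g₂ X, X) × hom(g₁ X, X) → hom(g X, X)` for `g = g₂ g₁`. -/
def orbitMul {g₂ g₁ g : Kˣ} (h : g = g₂ * g₁) :
    A.Hom (g₂ • X) X →ₗ[K] A.Hom (g₁ • X) X →ₗ[K] A.Hom (g • X) X :=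
  LinearMap.mk₂ K
    (fun b a => A.transport (h ▸ mul_smul g₂ g₁ X)
      (A.μ (((Chain.nil (g₂ • g₁ • X)).cons (R.strict.act g₂ a)).cons b)))
    (fun b b' a => by
      rw [← map_add]
      exact congrArg _ (A.μ_add ((Chain.nil _).cons (R.strict.act g₂ a)) b b' (Chain.nil X)))
    (fun c b a => by
      rw [← map_smul]
      exact congrArg _ (A.μ_smul ((Chain.nil _).cons (R.strict.act g₂ a)) c b (Chain.nil X)))
    (fun b a a' => by
      rw [← map_add, map_add]
      exact congrArg _ (A.μ_add (Chain.nil _) _ _ ((Chain.nil _).cons b)))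
    (fun c b a => by
      rw [← map_smul, map_smul]
      exact congrArg _ (A.μ_smul (Chain.nil _) c _ ((Chain.nil _).cons b)))

theorem orbitMul_apply {g₂ g₁ g : Kˣ} (h : g = g₂ * g₁) (h' : g • X = g₂ • g₁ • X)
    (b : A.Hom (g₂ • X) X) (a : A.Hom (g₁ • X) X) :
    R.orbitMul X h b a = A.transport h'
      (A.μ (((Chain.nil (g₂ • g₁ • X)).cons (R.strict.act g₂ a)).cons b)) := rfl

theorem orbitMul_leibniz {g₂ g₁ g : Kˣ} (h : g = g₂ * g₁) {i j : ZMod 2} {b : A.Hom (g₂ • X) X}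
    {a : A.Hom (g₁ • X) X} (hb : b ∈ A.deg _ _ i) (ha : a ∈ A.deg _ _ j) :
    A.differential _ _ (R.orbitMul X h b a) + R.orbitMul X h b (A.differential _ _ a) +
      sign (j - 1) • R.orbitMul X h (A.differential _ _ b) a = 0 := by
  have h' : g • X = g₂ • g₁ • X := by rw [h, mul_smul]
  simp only [R.orbitMul_apply X h h', A.differential_transport, ← map_zsmul, ← map_add,
    ← R.strict.differential_act]
  rw [A.leibniz (R.strict.act_mem g₂ j a ha) hb, map_zero]

/-- This and `orbitMul_orbitMul_right` bring both bracketings to the common source `g₃ g₂ g₁ X`,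
where the `A_∞`-relation can be applied. -/
theorem orbitMul_orbitMul_left {g₃ g₂ g₁ g₃₂ g : Kˣ} (h₃₂ : g₃₂ = g₃ * g₂) (h : g = g₃₂ * g₁)
    (h' : g • X = g₃ • g₂ • g₁ • X) (c : A.Hom (g₃ • X) X) (b : A.Hom (g₂ • X) X)
    (a : A.Hom (g₁ • X) X) :
    R.orbitMul X h (R.orbitMul X h₃₂ c b) a = A.transport h'
      (A.μ (((Chain.nil _).cons (R.strict.act g₃ (R.strict.act g₂ a))).cons
        (A.μ (((Chain.nil _).cons (R.strict.act g₃ b)).cons c)))) := by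
  subst h₃₂
  rw [R.orbitMul_apply X h (by rw [h, mul_smul]), R.orbitMul_apply X rfl (mul_smul g₃ g₂ X),
    A.μ_transport (mul_smul g₃ g₂ (g₁ • X)) (mul_smul g₃ g₂ X) (R.strict.act_mul g₃ g₂ a),
    A.transport_transport]

theorem orbitMul_orbitMul_right {g₃ g₂ g₁ g₂₁ g : Kˣ} (h₂₁ : g₂₁ = g₂ * g₁) (h : g = g₃ * g₂₁)
    (h' : g • X = g₃ • g₂ • g₁ • X) (c : A.Hom (g₃ • X) X) (b : A.Hom (g₂ • X) X)
    (a : A.Hom (g₁ • X) X) :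
    R.orbitMul X h c (R.orbitMul X h₂₁ b a) = A.transport h'
      (A.μ (((Chain.nil _).cons (A.μ (((Chain.nil _).cons
        (R.strict.act g₃ (R.strict.act g₂ a))).cons (R.strict.act g₃ b)))).cons c)) := by
  subst h₂₁
  have e := R.strict.act_μ g₃ (((Chain.nil _).cons (R.strict.act g₂ a)).cons b)
  simp only [Chain.map] at e
  rw [R.orbitMul_apply X h (by rw [h, mul_smul]), R.orbitMul_apply X rfl (mul_smul g₂ g₁ X), ← e]
  have := A.μ_transport (Z := g₃ • X) (congrArg (g₃ • ·) (mul_smul g₂ g₁ X)) rfl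
    (((R.strict.heq_act_transport g₃ (mul_smul g₂ g₁ X)
      (A.μ (((Chain.nil _).cons (R.strict.act g₂ a)).cons b)))).trans HEq.rfl) c
  rw [A.transport_rfl] at this
  rw [this, A.transport_transport]

/-- The ternary operation on the morphism spaces `hom(g X, X)`. -/
def orbitMul₃ {g₃ g₂ g₁ g : Kˣ} (h' : g • X = g₃ • g₂ • g₁ • X) (c : A.Hom (g₃ • X) X)
    (b : A.Hom (g₂ • X) X) (a : A.Hom (g₁ • X) X) : A.Hom (g • X) X :=
  A.transport h' (A.μ ((((Chain.nil _).cons (R.strict.act g₃ (R.strict.act g₂ a))).cons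
    (R.strict.act g₃ b)).cons c))

theorem orbitMul_assoc {g₃ g₂ g₁ g₃₂ g₂₁ g : Kˣ} (h₃₂ : g₃₂ = g₃ * g₂) (h₂₁ : g₂₁ = g₂ * g₁)
    (h : g = g₃₂ * g₁) (h' : g = g₃ * g₂₁) (h'' : g • X = g₃ • g₂ • g₁ • X)
    {c : A.Hom (g₃ • X) X} {b : A.Hom (g₂ • X) X} {a : A.Hom (g₁ • X) X}
    (hc : c ∈ A.deg _ _ 0) (hb : b ∈ A.deg _ _ 0) (ha : a ∈ A.deg _ _ 0)
    (hc' : A.differential _ _ c = 0) (hb' : A.differential _ _ b = 0)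
    (ha' : A.differential _ _ a = 0) :
    R.orbitMul X h (R.orbitMul X h₃₂ c b) a - R.orbitMul X h' c (R.orbitMul X h₂₁ b a) =
      A.differential _ _ (R.orbitMul₃ X h'' c b a) := by
  rw [R.orbitMul_orbitMul_left X h₃₂ h h'', R.orbitMul_orbitMul_right X h₂₁ h' h'', orbitMul₃,
    A.differential_transport, ← map_sub, A.associativity
      (R.strict.act_mem _ _ _ (R.strict.act_mem _ _ _ ha)) (R.strict.act_mem _ _ _ hb) hc
      (by rw [R.strict.differential_act, R.strict.differential_act, ha', map_zero, map_zero])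
      (by rw [R.strict.differential_act, hb', map_zero]) hc']

theorem orbitMul₃_mem {g₃ g₂ g₁ g : Kˣ} (h' : g • X = g₃ • g₂ • g₁ • X)
    {c : A.Hom (g₃ • X) X} {b : A.Hom (g₂ • X) X} {a : A.Hom (g₁ • X) X}
    (hc : c ∈ A.deg _ _ 0) (hb : b ∈ A.deg _ _ 0) (ha : a ∈ A.deg _ _ 0) :
    R.orbitMul₃ X h' c b a ∈ A.deg _ _ 1 :=
  A.transport_mem h' (A.μ_mem ((((Chain.nil _).cons
    (⟨0, _, R.strict.act_mem _ _ _ (R.strict.act_mem _ _ _ ha)⟩ :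
      A.toGradedQuiver.Homog _ _)).cons (⟨0, _, R.strict.act_mem _ _ _ hb⟩ :
      A.toGradedQuiver.Homog _ _)).cons (⟨0, c, hc⟩ : A.toGradedQuiver.Homog _ _)))

end RationalAction

/-! ### Algebraic expansions and the orbit algebra -/

namespace RationalAction

variable {K : Type u} [Field K] {Ob : Type v} [MulAction Kˣ Ob]
  {A : AInftyCategory.{u, v, w} K Ob} (R : RationalAction.{u, v, w, u'} A) (X : Ob)

theorem expansion_injective [Infinite K] {n n' : ℤ →₀ R.family.Hom X X}
    (h : ∀ z g : Kˣ, (n.sum fun k x => ((z ^ k : Kˣ) : K) • R.family.ev g x) =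
      n'.sum fun k x => ((z ^ k : Kˣ) : K) • R.family.ev g x) : n = n' := by
  rw [← sub_eq_zero]
  ext1 k
  refine R.ev_injective fun g => ?_
  have := OrbitAlgebra.eq_zero_of_sum_zpow_smul
    ((n - n').mapRange (R.family.ev g) (map_zero _)) fun z => by
      rw [Finsupp.sum_mapRange_index (by simp), Finsupp.sum_sub_index (by simp [smul_sub]), h,
        sub_self]
  exact DFunLike.congr_fun this k

theorem orbitMul_ev {g₂ g₁ g : Kˣ} (h : g = g₂ * g₁) (h' : g • X = (∏ i, ![g₁, g₂] i) • X)
    (b a : R.family.Hom X X) :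
    R.orbitMul X h (R.family.ev g₂ b) (R.family.ev g₁ a) =
      R.family.multiValue ![g₁, g₂] h' (R.family.μ (((Chain.nil X).cons a).cons b)) := by
  have e : g • X = g₂ • g₁ • X := by rw [h, mul_smul]
  have h2 := R.family_mu (((Chain.nil X).cons a).cons b) ![g₁, g₂]
  refine Eq.trans ?_ ((R.family.multiValue_transport ![g₁, g₂] e
    (iterSMul_eq ![g₁, g₂] X) (R.family.μ (((Chain.nil X).cons a).cons b))).symm)
  rw [R.orbitMul_apply X h e]
  exact congrArg (A.transport e) h2.symm

theorem orbitMul₃_ev {g₃ g₂ g₁ g : Kˣ} (h : g • X = g₃ • g₂ • g₁ • X)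
    (h' : g • X = (∏ i, ![g₁, g₂, g₃] i) • X) (c b a : R.family.Hom X X) :
    R.orbitMul₃ X h (R.family.ev g₃ c) (R.family.ev g₂ b) (R.family.ev g₁ a) =
      R.family.multiValue ![g₁, g₂, g₃] h'
        (R.family.μ ((((Chain.nil X).cons a).cons b).cons c)) := by
  have h2 := R.family_mu ((((Chain.nil X).cons a).cons b).cons c) ![g₁, g₂, g₃]
  refine Eq.trans ?_ ((R.family.multiValue_transport ![g₁, g₂, g₃] h
    (iterSMul_eq ![g₁, g₂, g₃] X) (R.family.μ ((((Chain.nil X).cons a).cons b).cons c))).symm)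
  exact congrArg (A.transport h) h2.symm

/-- Expansion of the product of two sections, for a given presentation of its coefficients. -/
theorem exists_expansion_orbitMul {N : Type*} [AddCommGroup N] [Module K[T;T⁻¹] N]
    (φ : N →ₗ[K[T;T⁻¹]] R.family.Hom X X) (b a : R.family.Hom X X)
    (hφ : R.family.μ (((Chain.nil X).cons a).cons b) ∈
      LinearMap.range (LinearMap.lTensor (CoordRing K 2) φ)) :
    ∃ n : ℤ →₀ N, ∀ {g₂ g₁ g : Kˣ} (h : g = g₂ * g₁),
      R.orbitMul X h (R.family.ev g₂ b) (R.family.ev g₁ a) =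
        n.sum fun k y => ((g₁ ^ k : Kˣ) : K) • R.family.ev g (φ y) := by
  obtain ⟨x, hx⟩ := hφ
  -- The curve is `g₁ = z`, `g₂ = g z⁻¹`, on which `T₁ ^ e₀ T₂ ^ e₁` becomes `z ^ (e₀ - e₁) g ^ e₁`.
  obtain ⟨n, hn⟩ := R.family.exists_expansion (fun z g => ![z, g * z⁻¹]) (by simp)
    (fun e => e 0 - e 1) (fun e => e 1)
    (fun z g e => by simp [mul_zpow, zpow_sub, mul_comm, mul_left_comm]) φ x
  refine ⟨n, fun {g₂ g₁ g} h => ?_⟩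
  obtain rfl : g₂ = g * g₁⁻¹ := by rw [h, mul_inv_cancel_right]
  rw [R.orbitMul_ev X h (by simp), ← hx, hn]

theorem exists_orbitProd (b a : R.family.Hom X X) : ∃ n : ℤ →₀ R.family.Hom X X,
    ∀ {g₂ g₁ g : Kˣ} (h : g = g₂ * g₁),
      R.orbitMul X h (R.family.ev g₂ b) (R.family.ev g₁ a) =
        n.sum fun k y => ((g₁ ^ k : Kˣ) : K) • R.family.ev g y :=
  R.exists_expansion_orbitMul X LinearMap.id b a ⟨_, by rw [LinearMap.lTensor_id]; rfl⟩

/-- The product of two sections, expanded in powers of the coordinate of the first factor. -/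
def orbitProd (b a : R.family.Hom X X) : ℤ →₀ R.family.Hom X X :=
  (R.exists_orbitProd X b a).choose

theorem orbitMul_ev_ev (b a : R.family.Hom X X) {g₂ g₁ g : Kˣ} (h : g = g₂ * g₁) :
    R.orbitMul X h (R.family.ev g₂ b) (R.family.ev g₁ a) =
      (R.orbitProd X b a).sum fun k y => ((g₁ ^ k : Kˣ) : K) • R.family.ev g y :=
  (R.exists_orbitProd X b a).choose_spec h

/-- The degree condition on `μ²` gives an expansion with coefficients in the right degree, and by
uniqueness it is the chosen one. -/
theorem orbitProd_mem [Infinite K] {i j : ZMod 2} {b a : R.family.Hom X X}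
    (hb : b ∈ R.family.deg X X i) (ha : a ∈ R.family.deg X X j) (k : ℤ) :
    R.orbitProd X b a k ∈ R.family.deg X X (i + j) := by
  have hdeg : ∀ i j : ZMod 2, 0 + (j - 1) + (i - 1) = i + j := by decide
  have hmem : R.family.μ (((Chain.nil X).cons a).cons b) ∈ LinearMap.range
      (LinearMap.lTensor (CoordRing K 2) (R.family.deg X X (i + j)).subtype) := by
    have h := R.μ_mem (((Chain.nil X).cons (⟨j, a, ha⟩ : R.family.Homog X X)).cons
      (⟨i, b, hb⟩ : R.family.Homog X X))
    rw [show GradedQuiver.reducedDegree (((Chain.nil X).cons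
      (⟨j, a, ha⟩ : R.family.Homog X X)).cons (⟨i, b, hb⟩ : R.family.Homog X X)) = i + j from
      hdeg i j] at h
    exact h
  obtain ⟨n, hn⟩ := R.exists_expansion_orbitMul X _ b a hmem
  have e : R.orbitProd X b a = Finsupp.mapRange.linearMap (R.family.deg X X (i + j)).subtype n := by
    refine R.expansion_injective X fun z g => ?_
    rw [← R.orbitMul_ev_ev X b a (inv_mul_cancel_right g z).symm, hn,
      Finsupp.mapRange.linearMap_apply, Finsupp.sum_mapRange_index (by simp)]
  rw [e, Finsupp.mapRange.linearMap_apply, Finsupp.mapRange_apply]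
  exact (n k).2

theorem differential_ev (g : Kˣ) (a : R.family.Hom X X) :
    A.differential (g • X) X (R.family.ev g a) = R.family.ev g (R.differential X X a) :=
  (R.value_differential g rfl a).symm

/-- The operation `μ³` of the family, restricted to `g₁ = 1`, `g₂ = z`, `g₃ = g z⁻¹`, is the
algebraic homotopy. -/
theorem exists_orbitProd_assoc {c b a : R.family.Hom X X} (hc : c ∈ R.family.deg X X 0)
    (hb : b ∈ R.family.deg X X 0) (ha : a ∈ R.family.deg X X 0) (hc' : R.differential X X c = 0)
    (hb' : R.differential X X b = 0) (ha' : R.differential X X a = 0) :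
    ∃ n : ℤ →₀ R.family.Hom X X, (∀ k, n k ∈ R.family.deg X X 1) ∧
      ∀ {g₃ g₂ g : Kˣ} (h : g = g₃ * g₂) (h₁ : g = g * 1) (h₂ : g₂ = g₂ * 1),
        R.orbitMul X h₁ (R.orbitMul X h (R.family.ev g₃ c) (R.family.ev g₂ b))
            (R.family.ev 1 a) -
          R.orbitMul X h (R.family.ev g₃ c) (R.orbitMul X h₂ (R.family.ev g₂ b)
            (R.family.ev 1 a)) =
        n.sum fun k x => ((g₂ ^ k : Kˣ) : K) • R.family.ev g (R.differential X X x) := by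
  obtain ⟨x, hx⟩ := R.μ_mem ((((Chain.nil X).cons (⟨0, a, ha⟩ : R.family.Homog X X)).cons
    (⟨0, b, hb⟩ : R.family.Homog X X)).cons (⟨0, c, hc⟩ : R.family.Homog X X))
  obtain ⟨n, hn⟩ := R.family.exists_expansion (fun z g => ![1, z, g * z⁻¹])
    (by simp [Fin.prod_univ_three]) (fun e => e 1 - e 2) (fun e => e 2)
    (fun z g e => by simp [Fin.prod_univ_three, mul_zpow, zpow_sub, mul_comm, mul_left_comm])
    (R.family.deg X X 1).subtype x
  refine ⟨Finsupp.mapRange.linearMap (R.family.deg X X 1).subtype n, fun k => (n k).2,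
    fun {g₃ g₂ g} h h₁ h₂ => ?_⟩
  have e : g • X = g₃ • g₂ • (1 : Kˣ) • X := by rw [h, mul_smul, one_smul]
  have hcl : ∀ {g : Kˣ} {y : R.family.Hom X X}, R.differential X X y = 0 →
      A.differential (g • X) X (R.family.ev g y) = 0 := fun hy => by
    rw [differential_ev, hy, map_zero]
  rw [R.orbitMul_assoc X h h₂ h₁ h e (R.ev_mem _ _ _ hc) (R.ev_mem _ _ _ hb)
    (R.ev_mem _ _ _ ha) (hcl hc') (hcl hb') (hcl ha')]
  obtain rfl : g₃ = g * g₂⁻¹ := by rw [h, mul_inv_cancel_right]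
  rw [R.orbitMul₃_ev X e (by simp [Fin.prod_univ_three])]
  have := hn g₂ g (by simp [Fin.prod_univ_three])
  rw [Finsupp.mapRange.linearMap_apply, Finsupp.sum_mapRange_index (by simp)]
  refine (congrArg (A.differential (g • X) X) ((congrArg _ hx.symm).trans this)).trans ?_
  simp only [Finsupp.sum, map_sum, map_smul, differential_ev]

theorem orbitMul_unit (h : (1 : Kˣ) = 1 * 1) {i : ZMod 2} {b : A.Hom ((1 : Kˣ) • X) X}
    (hb : b ∈ A.deg _ _ i) (hb' : A.differential _ _ b = 0) :
    ∃ n ∈ A.deg ((1 : Kˣ) • X) X (i - 1),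
      R.orbitMul X h b (A.transport (one_smul Kˣ X) (A.unit X)) - b = A.differential _ _ n := by
  have hX := one_smul Kˣ X
  obtain ⟨b, rfl⟩ := (A.transport (Y := X) hX).surjective b
  have hb1 : b ∈ A.deg X X i := by
    have := A.transport_mem hX.symm hb
    rwa [A.transport_transport, A.transport_rfl] at this
  have hb2 : A.differential X X b = 0 := by
    rw [A.differential_transport] at hb'
    exact (LinearEquiv.map_eq_zero_iff _).mp hb'
  obtain ⟨n, hn, e⟩ := A.unit_right i b hb1 hb2
  refine ⟨A.transport hX n, A.transport_mem hX hn, ?_⟩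
  have hXX : (1 : Kˣ) • (1 : Kˣ) • X = X := by rw [hX, hX]
  rw [R.orbitMul_apply X h (by rw [hX, hX]), A.μ_transport hXX hX
    ((R.strict.heq_act_transport 1 hX (A.unit X)).trans (R.strict.act_one _)) b,
    A.transport_transport, A.differential_transport, ← map_sub, e]
  rfl

/-- The endomorphisms of the orbit of an object. -/
def orbitAlgebra [Infinite K] :
    OrbitAlgebra K (R.family.Hom X X) (fun g => A.Hom (g • X) X) where
  deg := R.family.deg X X
  d := R.differential X X
  fibreDeg g := A.deg (g • X) X
  fibreD g := A.differential (g • X) X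
  ev g := R.family.ev g
  d_mem := R.differential_mem
  d_sq := R.differential_sq_of_mem
  ev_mem g _ _ ha := R.ev_mem g _ _ ha
  ev_surjective g _ _ hb := R.ev_surjective g _ _ hb
  ev_kernel g _ _ ha h := R.ev_kernel g _ _ ha h
  ev_d g a := (R.differential_ev X g a).symm
  ev_injective := R.ev_injective
  smul_cancel hf _ h := R.smul_cancel hf h
  mul h := R.orbitMul X h
  prod := R.orbitProd X
  prod_mem := R.orbitProd_mem X
  ev_prod h b a := R.orbitMul_ev_ev X b a h
  leibniz h _ _ _ _ hb ha := R.orbitMul_leibniz X h hb ha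
  assoc {g₃ g₂ g₁ g₃₂ g₂₁ g} h₃₂ h₂₁ h h' {c b a} hc hb ha hc' hb' ha' :=
    have h'' : g • X = g₃ • g₂ • g₁ • X := by rw [h, h₃₂, mul_smul, mul_smul]
    ⟨R.orbitMul₃ X h'' c b a, R.orbitMul₃_mem X h'' hc hb ha,
      R.orbitMul_assoc X h₃₂ h₂₁ h h' h'' hc hb ha hc' hb' ha'⟩
  assoc_one := R.exists_orbitProd_assoc X
  one := A.transport (one_smul Kˣ X) (A.unit X)
  one_mem := A.transport_mem _ (A.unit_mem X)
  one_closed := by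
    rw [A.differential_transport, show A.differential X X (A.unit X) = 0 from A.unit_closed X,
      map_zero]
  mul_one h _ _ hb hb' := R.orbitMul_unit X h hb hb'

end RationalAction

/-! ## The cotangent space at the unit -/

section Cotangent

variable (K : Type u) [Field K]

/-- The ring homomorphism `K[𝔾_m] → K[ε]` given by the tangent vector `T ↦ 1 + ε`. -/
def tangentEval : K[T;T⁻¹] →+* DualNumber K :=
  LaurentPolynomial.eval₂ (algebraMap K (DualNumber K))
    ⟨1 + DualNumber.eps, 1 - DualNumber.eps, by
      rw [← sq_sub_sq, pow_two DualNumber.eps, DualNumber.eps_mul_eps]; ring, by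
      rw [mul_comm, ← sq_sub_sq, pow_two DualNumber.eps, DualNumber.eps_mul_eps]; ring⟩

theorem fst_tangentEval (f : K[T;T⁻¹]) : (tangentEval K f).fst = evalAt 1 f := by
  have h : (TrivSqZeroExt.fstHom K K K).toRingHom.comp (tangentEval K) = evalAt 1 := by
    have hu : ∀ x : (DualNumber K)ˣ, (x : DualNumber K).fst = 1 → ∀ n : ℤ,
        ((x ^ n : (DualNumber K)ˣ) : DualNumber K).fst = 1 := fun x hx n => by
      have h1 : Units.map (TrivSqZeroExt.fstHom K K K).toRingHom.toMonoidHom x = 1 :=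
        Units.ext hx
      have h2 := congrArg (fun y : Kˣ => ((y ^ n : Kˣ) : K)) h1
      simpa [← map_zpow] using h2
    apply laurent_ringHom_ext
    · intro c
      simp [tangentEval]
    · intro n
      rw [evalAt_T, one_zpow]
      change (tangentEval K (T n)).fst = _
      rw [tangentEval, LaurentPolynomial.eval₂_T]
      exact hu _ (by simp) n
  exact DFunLike.congr_fun h f

/-- The tangent vector `T ↦ 1 + ε` kills the square of the ideal but sends `T - 1` to `ε`. Hence
vanishing of the deformation class means vanishing of its factor in `H¹`. -/
theorem dT_ne_zero : dT K ≠ 0 := by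
  rw [dT, Ne, Ideal.toCotangent_eq_zero]
  intro h
  have hle : idealOne K ^ 2 ≤ RingHom.ker (tangentEval K) := by
    rw [pow_two, Ideal.mul_le]
    intro f hf g hg
    have hf' : (tangentEval K f).fst = 0 := (fst_tangentEval K f).trans hf
    have hg' : (tangentEval K g).fst = 0 := (fst_tangentEval K g).trans hg
    rw [RingHom.mem_ker, map_mul]
    ext <;> simp [hf', hg']
  have h2 := congrArg TrivSqZeroExt.snd (RingHom.mem_ker.mp (hle h))
  simp [tangentEval] at h2

theorem eq_zero_of_dT_tmul_eq_zero {W : Type*} [AddCommGroup W] [Module K W] {x : W}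
    (h : dT K ⊗ₜ[K] x = 0) : x = 0 := by
  obtain ⟨φ, hφ⟩ : ∃ φ : Module.Dual K (LieDual K), φ (dT K) ≠ 0 := by
    by_contra! hφ
    exact dT_ne_zero K ((Module.forall_dual_apply_eq_zero_iff K _).mp hφ)
  have h2 := congrArg (fun y => TensorProduct.lid K W (LinearMap.rTensor W φ y)) h
  simp only [LinearMap.rTensor_tmul, TensorProduct.lid_tmul, map_zero] at h2
  exact (smul_eq_zero.mp h2).resolve_left hφ

end Cotangent

/-! ## Weakly equivariant structures -/

namespace RationalAction

variable {K : Type u} [Field K] {Ob : Type v} [MulAction Kˣ Ob]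
  {A : AInftyCategory.{u, v, w} K Ob} (R : RationalAction.{u, v, w, u'} A) (X : Ob)

variable [Infinite K]

theorem mem_fibreExact_orbitAlgebra {a : A.Hom ((1 : Kˣ) • X) X} :
    a ∈ (R.orbitAlgebra X).FibreExact 1 ↔
      ∃ b ∈ A.deg X X (-1), A.differential X X b =
        A.transport (one_smul Kˣ X).symm a := by
  have hX := one_smul Kˣ X
  constructor
  · rintro ⟨b, hb, rfl⟩
    refine ⟨A.transport hX.symm b, ?_, A.differential_transport _ _⟩
    rw [← zero_sub]
    exact A.transport_mem _ hb
  · rintro ⟨b, hb, e⟩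
    rw [← zero_sub] at hb
    refine ⟨A.transport hX b, A.transport_mem hX hb, ?_⟩
    change A.differential _ _ (A.transport hX b) = a
    rw [A.differential_transport, e, A.transport_transport, A.transport_rfl]

/-- If the unit were exact, multiplication by it would make every degree zero class vanish,
contradicting dimension one. -/
theorem one_notMem_fibreExact (hsimple : A.IsSimple X) :
    (R.orbitAlgebra X).one ∉ (R.orbitAlgebra X).FibreExact 1 := by
  intro h
  have : Subsingleton (A.H 0 X X) := by
    refine subsingleton_of_forall_eq 0 fun x => ?_
    obtain ⟨⟨a, ha, ha'⟩, rfl⟩ := Submodule.Quotient.mk_surjective _ x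
    have hX := one_smul Kˣ X
    have h1 := A.transport_mem hX ha
    have h2 : A.differential _ _ (A.transport hX a) = 0 := by
      rw [A.differential_transport, show A.differential X X a = 0 from ha', map_zero]
    obtain ⟨n, hn, e⟩ := (R.orbitAlgebra X).mul_one (_root_.mul_one 1).symm h1 h2
    have h3 := (R.orbitAlgebra X).mul_mem_fibreExact_right (_root_.mul_one 1).symm h1 h2 h
    have h4 : A.transport hX a ∈ (R.orbitAlgebra X).FibreExact 1 := by
      have := sub_mem h3 (⟨n, hn, rfl⟩ :
        (R.orbitAlgebra X).fibreD 1 n ∈ (R.orbitAlgebra X).FibreExact 1)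
      rwa [← e, sub_sub_cancel] at this
    obtain ⟨b, hb, e⟩ := (R.mem_fibreExact_orbitAlgebra X).mp h4
    rw [Submodule.Quotient.mk_eq_zero]
    exact ⟨b, by rwa [← zero_sub] at hb, by rw [e, A.transport_transport]; rfl⟩
  have h0 := Module.finrank_zero_of_subsingleton (R := K) (M := A.H 0 X X)
  exact zero_ne_one (h0.symm.trans hsimple)

theorem exists_sub_smul_one_mem (hsimple : A.IsSimple X) {a : A.Hom ((1 : Kˣ) • X) X}
    (ha : a ∈ A.deg _ _ 0) (ha' : A.differential _ _ a = 0) :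
    ∃ c : K, a - c • (R.orbitAlgebra X).one ∈ (R.orbitAlgebra X).FibreExact 1 := by
  have hX := one_smul Kˣ X
  have hne : A.unitClass X ≠ 0 := by
    intro h
    obtain ⟨b, hb, e⟩ := (Submodule.Quotient.mk_eq_zero _).mp h
    apply R.one_notMem_fibreExact X hsimple
    rw [mem_fibreExact_orbitAlgebra]
    refine ⟨b, by rwa [← zero_sub], e.trans ?_⟩
    exact (A.transport_transport hX.symm hX _).symm
  obtain ⟨c, hc⟩ := (finrank_eq_one_iff_of_nonzero' _ hne).mp hsimple
    (Submodule.Quotient.mk ⟨A.transport hX.symm a, A.transport_mem _ ha, LinearMap.mem_ker.mpr <| by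
      rw [A.differential_transport, ha', map_zero]⟩)
  refine ⟨c, ?_⟩
  obtain ⟨b, hb, e⟩ := (Submodule.Quotient.eq _).mp hc.symm
  rw [mem_fibreExact_orbitAlgebra]
  have h1 : A.transport hX.symm (a - c • A.transport hX (A.unit X)) =
      A.transport hX.symm a - c • A.unit X := by
    rw [map_sub, map_smul, A.transport_transport, A.transport_rfl]
  exact ⟨b, by rwa [← zero_sub], e.trans h1.symm⟩

theorem exists_cocycle_eq_unit [CharZero K] (hproper : R.IsProper)
    (hinf : R.IsInfinitesimallyEquivariant X) :
    ∃ σ ∈ Cocycles (R.family.deg X X) (R.differential X X) 0,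
      R.family.ev 1 σ = (R.orbitAlgebra X).one := by
  have hX := one_smul Kˣ X
  obtain ⟨⟨a, z⟩, h⟩ := R.exists_isLift X
  rw [IsInfinitesimallyEquivariant, R.deformationClass_eq h] at hinf
  obtain ⟨b, hb, e⟩ := (Submodule.Quotient.mk_eq_zero _).mp (eq_zero_of_dT_tmul_eq_zero K hinf)
  have : Module.Finite K[T;T⁻¹] (Cohomology (R.orbitAlgebra X).deg (R.orbitAlgebra X).d 1) :=
    hproper X X 1
  refine (R.orbitAlgebra X).exists_cocycle h.left_mem ?_ h.right_mem h.differential_left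
    ⟨A.transport hX b, A.transport_mem hX hb, ?_⟩
  · have := h.value_left
    rw [R.family.value_eq_transport] at this
    change R.family.ev 1 a = A.transport hX (A.unit X)
    rw [← this, A.transport_transport]
    rfl
  · change R.family.ev 1 z = A.differential _ _ (A.transport hX b)
    rw [A.differential_transport]
    have e' : A.differential X X b = R.family.value 1 hX.symm z := e
    rw [e', R.family.value_eq_transport, A.transport_transport]
    rfl

end RationalAction

/-- A section which is multiplicative up to an algebraic homotopy is a weakly equivariant
structure. -/
def WeaklyEquivariantStructure.ofMultiplicative {K : Type u} [Field K] [Infinite K] {Ob : Type v}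
    [MulAction Kˣ Ob] {A : AInftyCategory.{u, v, w} K Ob} (R : RationalAction.{u, v, w, u'} A)
    (X : Ob) (ρ : R.family.Hom X X)
    (hρ : ρ ∈ Cocycles (R.family.deg X X) (R.differential X X) 0)
    (hρ1 : R.family.ev 1 ρ - (R.orbitAlgebra X).one ∈ (R.orbitAlgebra X).FibreExact 1)
    (c : ℤ →₀ R.family.Hom X X) (hc : ∀ k, c k ∈ R.family.deg X X (0 - 1))
    (hprod : R.orbitProd X ρ ρ = Finsupp.single 0 ρ + (R.orbitAlgebra X).dC c) :
    WeaklyEquivariantStructure R X where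
  rho := ρ
  rho_mem := hρ.1
  closed g := by
    rw [R.differential_ev, show R.differential X X ρ = 0 from hρ.2, map_zero]
  unital := by
    obtain ⟨b, hb, e⟩ := (R.mem_fibreExact_orbitAlgebra X).mp hρ1
    refine ⟨b, hb, ?_⟩
    rw [e, map_sub, R.family.value_eq_transport]
    change _ = _ - A.transport _ (A.transport _ (A.unit X))
    rw [A.transport_transport]
    rfl
  associative := by
    -- `ρ²` is minus the sum of the `T₁ ^ k ⊗ c_k`. Index `0` of the exponent is the variable of
    -- `g₁`, so the value at `(g₁, g₂)` is minus the expansion of `c` at `z = g₁`, `g = g₂ g₁`.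
    refine ⟨-c.sum fun k y => CoordRing.monomial ![k, 0] 1 ⊗ₜ y, neg_mem (Submodule.sum_mem _
      fun k _ => ⟨CoordRing.monomial ![k, 0] 1 ⊗ₜ ⟨c k, zero_sub (1 : ZMod 2) ▸ hc k⟩, rfl⟩),
      fun g₁ g₂ => ?_⟩
    have hX := mul_smul g₂ g₁ X
    have h1 := R.orbitMul_ev_ev X ρ ρ (rfl : g₂ * g₁ = g₂ * g₁)
    have h2 := (R.orbitAlgebra X).evc_dC g₁ (g₂ * g₁) c
    have h3 : R.family.multiValue ![g₁, g₂]
        (by simp [mul_comm g₁ g₂, mul_smul] : g₂ • g₁ • X = (∏ i, ![g₁, g₂] i) • X)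
        (c.sum fun k y => CoordRing.monomial ![k, 0] 1 ⊗ₜ y) =
        A.transport hX.symm ((R.orbitAlgebra X).evc g₁ (g₂ * g₁) c) := by
      rw [OrbitAlgebra.evc_apply, Finsupp.sum, Finsupp.sum, map_sum, map_sum]
      refine Finset.sum_congr rfl fun k _ => ?_
      rw [R.family.multiValue_tmul, CoordRing.evalMulti_monomial,
        R.family.value_congr (by simp [mul_comm]) _ hX.symm, R.family.value_eq_transport,
        map_smul]
      simp
      rfl
    have h4 : (R.orbitProd X ρ ρ).sum (fun k y =>
        ((g₁ ^ k : Kˣ) : K) • R.family.ev (g₂ * g₁) y) = R.family.ev (g₂ * g₁) ρ +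
        A.differential _ _ ((R.orbitAlgebra X).evc g₁ (g₂ * g₁) c) := by
      change (R.orbitAlgebra X).evc g₁ (g₂ * g₁) (R.orbitProd X ρ ρ) = _
      rw [hprod, map_add, h2, OrbitAlgebra.evc_single, zpow_zero, Units.val_one, one_smul]
      rfl
    rw [h4, R.orbitMul_apply X rfl hX] at h1
    have h5 := congrArg (A.transport hX.symm) h1
    rw [A.transport_transport, A.transport_rfl, map_add, ← A.differential_transport] at h5
    rw [h5, map_neg, h3, map_neg, R.family.value_eq_transport]
    abel

end AInfty
end

theorem mainTheorem8 {K : Type*} [Field K] [CharZero K] {Ob : Type*} [MulAction Kˣ Ob]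
    (A : AInfty.AInftyCategory K Ob) (R : AInfty.RationalAction A) (hproper : R.IsProper)
    (X : Ob) (hinf : R.IsInfinitesimallyEquivariant X) (hsimple : A.IsSimple X) :
    Nonempty (AInfty.WeaklyEquivariantStructure R X) := by
  obtain ⟨σ, hσ, hσ1⟩ := R.exists_cocycle_eq_unit X hproper hinf
  have : Module.Finite (LaurentPolynomial K)
      (AInfty.Cohomology (R.orbitAlgebra X).deg (R.orbitAlgebra X).d 0) := hproper X X 0
  obtain ⟨ρ, hρ, hρ1, c, hc, hprod⟩ := (R.orbitAlgebra X).exists_multiplicative hσ hσ1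
    (fun a ha ha' => R.exists_sub_smul_one_mem X hsimple ha ha')
    (R.one_notMem_fibreExact X hsimple)
  exact ⟨.ofMultiplicative R X ρ hρ hρ1 c hc hprod⟩
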